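/- A Borel space is a non-empty Borel subset of a complete separable metric space. A constrained discounted Markov decision process consists of Borel spaces $S$ (states) and $A$ (actions); a Borel set $\mathbb K\subset S\times A$ all of whose sections $A(s)=\{a:(s,a)\in\mathbb K\}$ are non-empty; a transition probability $p$ from $\mathbb K$ to $S$; an initial distribution $\mu$ on $S$; Borel measurable functions $r_0,r_1,\dots,r_m:\mathbb K\to\mathbb R\cup\{-\infty\}$; and a discount factor $\beta\in(0,1)$. A policy is a sequence $\pi=(\pi_n)_{n\ge1}$ of transition probabilities $\pi_n$ from $\mathbb K^{n-1}\times S$ (the histories $h_n=(s_1,a_1,\dots,s_{n-1},a_{n-1},s_n)$) to $A$ with $\pi_n(A(s_n)\mid h_n)=1$ for all $h_n$; $\Pi$ is the set of all policies. A (randomized) stationary policy is a transition probability $\varphi$ from $S$ to $A$ with $\varphi(A(s)\mid s)=1$ for all $s\in S$, identified with the policy $\pi_n(\cdot\mid h_n)=\varphi(\cdot\mid s_n)$. Let $P^\pi_\mu$ be the law of the process $(s_1,a_1,s_2,a_2,\dots)$ generated by $\mu$, $\pi$ and $p$, let $E^\pi_\mu$ be its expectation, and put $$J_i(\pi)=E^\pi_\mu\Big(\sum_{n\ge1}\beta^{n-1}r_i^+(s_n,a_n)\Big)-E^\pi_\mu\Big(\sum_{n\ge1}\beta^{n-1}(-r_i)^+(s_n,a_n)\Big),\qquad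 i=0,\dots,m,$$ where $x^+=\max\{x,0\}$. Under (A1)-(A2) below the first term is finite, so that $J_i(\pi)=E^\pi_\mu\big(\sum_{n\ge1}\beta^{n-1}r_i(s_n,a_n)\big)\in\mathbb R\cup\{-\infty\}$. Let $d_1,\dots,d_m\in\mathbb R$. The constrained problem (CP) is to maximize $J_0(\pi)$ over $\pi\in\Pi$ subject to $J_i(\pi)\ge d_i$ for $i=1,\dots,m$. It is assumed to be non-trivial: some $\pi\in\Pi$ satisfies all the constraints and $J_0(\pi)>-\infty$. Conditions (A1)-(A2), for a function $w:S\to[1,\infty)$: (A1) $w$ is Borel measurable and $r_i(s,a)\le w(s)$ for all $(s,a)\in\mathbb K$ and $i=0,\dots,m$. (A2) $\lim_{n\to\infty}\sup_{\pi\in\Pi}E^\pi_\mu\big(\sum_{k\ge n}\beta^{k-1}w(s_k)\big)=0$, and for every $n\ge1$, $\lim_{l\to\infty}\sup_{\pi\in\Pi}E^\pi_\mu\big(w(s_n)1_{\{w(s_n)\ge l\}}\big)=0$. Weak continuity conditions: (W1) every $A(s)$ is compact, and $\{s\in S:A(s)\cap B\ne\emptyset\}$ is closed for every closed $B\subset A$.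 (W2) $(s,a)\mapsto\int_S v(t)\,p(dt\mid s,a)$ is continuous on $\mathbb K$ for every bounded continuous $v:S\to\mathbb R$. (W3) each $r_i$ is upper semicontinuous on $\mathbb K$. Setwise continuity conditions: (S1) every $A(s)$ is compact. (S2) $a\mapsto p(D\mid s,a)$ is continuous on $A(s)$ for every $s\in S$ and every Borel $D\subset S$. (S3) $a\mapsto r_i(s,a)$ is upper semicontinuous on $A(s)$ for every $s\in S$ and every $i$. Theorem 1. Assume that (A1)-(A2) hold for some $w$, and that either (W1)-(W3) or (S1)-(S3) hold. Then there is a stationary policy $\varphi^*$ that is optimal for (CP), i.e. $J_i(\varphi^*)\ge d_i$ for $i=1,\dots,m$ and $J_0(\varphi^*)\ge J_0(\pi)$ for every $\pi\in\Pi$ with $J_i(\pi)\ge d_i$, $i=1,\dots,m$. -/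

import Mathlib

open MeasureTheory ProbabilityTheory Filter Topology
open scoped ENNReal

universe u v

/-- A *Borel space*: a non-empty topological space that is (homeomorphic to) a Borel subset of a
complete separable metric space. -/
structure IsBorelSpace (Y : Type u) [TopologicalSpace Y] : Prop where
  nonempty : Nonempty Y
  exists_embedding : ∃ (X : Type u) (_ : TopologicalSpace X) (_ : PolishSpace X) (f : Y → X),
    IsEmbedding f ∧ MeasurableSet[borel X] (Set.range f)

/-- A constrained discounted Markov decision process with state space `S`, action space `A` and
`m` constraints. The rewards are indexed by `Fin (m + 1)`: `r 0` is the stage reward and `r i.succ`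
for `i : Fin m` are the sources of constraints. They take values in `ℝ ∪ {-∞}`. -/
structure CMDP (S : Type u) (A : Type v) [MeasurableSpace S] [MeasurableSpace A] (m : ℕ) where
  /-- the set of feasible state-action pairs -/
  K : Set (S × A)
  measurableSet_K : MeasurableSet K
  exists_action : ∀ s : S, ∃ a : A, (s, a) ∈ K
  /-- the transition probability from `K` to `S` -/
  p : Kernel K S
  isMarkovKernel_p : IsMarkovKernel p
  /-- the initial distribution -/
  μ : Measure S
  isProbabilityMeasure_μ : IsProbabilityMeasure μ
  /-- the reward functions -/
  r : Fin (m + 1) → K → EReal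
  measurable_r : ∀ i, Measurable (r i)
  r_ne_top : ∀ i x, r i x ≠ ⊤
  /-- the discount factor -/
  β : ℝ
  β_pos : 0 < β
  β_lt_one : β < 1

namespace CMDP

noncomputable section

variable {S : Type u} {A : Type v} [MeasurableSpace S] [MeasurableSpace A] {m : ℕ}

/-- The set `A(s)` of actions available in state `s`. -/
def actions (M : CMDP S A m) (s : S) : Set A := {a | (s, a) ∈ M.K}

/-- Feasible histories `(s₀, a₀, …, sₙ₋₁, aₙ₋₁, sₙ)`; time starts at `0`. -/
abbrev History (M : CMDP S A m) (n : ℕ) : Type (max u v) := (Fin n → M.K) × S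

/-- A (randomized, history-dependent) policy. -/
structure Policy (M : CMDP S A m) where
  kernel : (n : ℕ) → Kernel (M.History n) A
  isMarkovKernel : ∀ n, IsMarkovKernel (kernel n)
  feasible : ∀ n (h : M.History n), kernel n h (M.actions h.2) = 1

/-- A (randomized) stationary policy: a transition probability `φ` from `S` to `A`
with `φ(A(s) | s) = 1`. -/
structure StationaryPolicy (M : CMDP S A m) where
  kernel : Kernel S A
  isMarkovKernel : IsMarkovKernel kernel
  feasible : ∀ s, kernel s (M.actions s) = 1

/-- A stationary policy, as the policy that uses `φ(· | sₙ)` at every time `n`. -/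
def StationaryPolicy.toPolicy {M : CMDP S A m} (φ : M.StationaryPolicy) : M.Policy where
  kernel n := φ.kernel.comap (fun h : M.History n => h.2) measurable_snd
  isMarkovKernel n := by
    have := φ.isMarkovKernel
    infer_instance
  feasible n h := by
    rw [Kernel.comap_apply]
    exact φ.feasible h.2

/-- The law of the state at time `n` given the preceding state-action pairs: the initial
distribution for `n = 0`, and `p(· | sₙ₋₁, aₙ₋₁)` otherwise. -/
def stateKernel (M : CMDP S A m) : (n : ℕ) → Kernel (Fin n → M.K) S
  | 0 => Kernel.const _ M.μ
  | n + 1 => M.p.comap (fun x : Fin (n + 1) → M.K => x (Fin.last n)) (measurable_pi_apply _)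

instance isMarkovKernel_stateKernel (M : CMDP S A m) (n : ℕ) :
    IsMarkovKernel (M.stateKernel n) := by
  have := M.isMarkovKernel_p
  have := M.isProbabilityMeasure_μ
  cases n <;> unfold stateKernel <;> infer_instance

/-- The law of the state-action pair at time `n` given the preceding state-action pairs, as a
measure on `S × A`. -/
def pairKernel (M : CMDP S A m) (π : M.Policy) (n : ℕ) : Kernel (Fin n → M.K) (S × A) :=
  M.stateKernel n ⊗ₖ π.kernel n

theorem pairKernel_K (M : CMDP S A m) (π : M.Policy) (n : ℕ) (x : Fin n → M.K) :
    M.pairKernel π n x M.K = 1 := by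
  have := π.isMarkovKernel n
  rw [pairKernel, Kernel.compProd_apply M.measurableSet_K]
  have h : ∀ s : S, π.kernel n (x, s) (Prod.mk s ⁻¹' M.K) = 1 := fun s => π.feasible n (x, s)
  simp [h]

/-- The law of the state-action pair at time `n` given the preceding ones, as a measure on `K`. -/
def stepKernel (M : CMDP S A m) (π : M.Policy) (n : ℕ) : Kernel (Fin n → M.K) M.K :=
  (M.pairKernel π n).comapRight (MeasurableEmbedding.subtype_coe M.measurableSet_K)

instance isMarkovKernel_stepKernel (M : CMDP S A m) (π : M.Policy) (n : ℕ) :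
    IsMarkovKernel (M.stepKernel π n) := by
  refine Kernel.IsMarkovKernel.comapRight _ _ fun x => ?_
  rw [Subtype.range_coe]
  exact M.pairKernel_K π n x

/-- `stepKernel`, indexed as the Ionescu-Tulcea construction `Kernel.traj` requires it. -/
def trajKernel (M : CMDP S A m) (π : M.Policy) (n : ℕ) :
    Kernel ((i : Finset.Iic n) → (fun _ : ℕ => M.K) i) M.K :=
  (M.stepKernel π (n + 1)).comap
    (fun x (i : Fin (n + 1)) => x ⟨i, Finset.mem_Iic.2 (Nat.lt_succ_iff.1 i.2)⟩)
    (measurable_pi_lambda _ fun _ => measurable_pi_apply _)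

instance isMarkovKernel_trajKernel (M : CMDP S A m) (π : M.Policy) (n : ℕ) :
    IsMarkovKernel (M.trajKernel π n) := by
  unfold trajKernel
  infer_instance

/-- The strategic measure `P_μ^π` on the space `K^∞` of trajectories `(s₀, a₀, s₁, a₁, …)`. -/
def strategicMeasure (M : CMDP S A m) (π : M.Policy) : Measure (ℕ → M.K) :=
  ((M.stepKernel π 0 Fin.elim0).map
    (fun x (_ : Finset.Iic 0) => x)).bind
      (Kernel.traj (X := fun _ : ℕ => M.K) (M.trajKernel π) 0)

/-- The state `sₙ` of a trajectory. -/
def state (M : CMDP S A m) (n : ℕ) (ω : ℕ → M.K) : S := (ω n).1.1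

/-- `βⁿ` as an extended nonnegative real. -/
def discount (M : CMDP S A m) (n : ℕ) : ℝ≥0∞ := ENNReal.ofReal (M.β ^ n)

/-- The expected total discounted positive part of `r i`. -/
def Jpos (M : CMDP S A m) (i : Fin (m + 1)) (π : M.Policy) : ℝ≥0∞ :=
  ∫⁻ ω, ∑' n, M.discount n * (M.r i (ω n)).toENNReal ∂(M.strategicMeasure π)

/-- The expected total discounted negative part of `r i` (in absolute value). -/
def Jneg (M : CMDP S A m) (i : Fin (m + 1)) (π : M.Policy) : ℝ≥0∞ :=
  ∫⁻ ω, ∑' n, M.discount n * (-(M.r i (ω n))).toENNReal ∂(M.strategicMeasure π)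

/-- The expected total discounted reward `J_i(π)`, with values in `[-∞, ∞]`. The difference is
meaningful whenever the positive part has finite expectation. -/
def J (M : CMDP S A m) (i : Fin (m + 1)) (π : M.Policy) : EReal :=
  (M.Jpos i π : EReal) - (M.Jneg i π : EReal)

/-- `π` satisfies the constraints `J_i(π) ≥ d_i`. -/
def Feasible (M : CMDP S A m) (d : Fin m → ℝ) (π : M.Policy) : Prop :=
  ∀ i : Fin m, (d i : EReal) ≤ M.J i.succ π

/-- The constrained problem is non-trivial. -/
def Nontrivial (M : CMDP S A m) (d : Fin m → ℝ) : Prop :=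
  ∃ π : M.Policy, M.Feasible d π ∧ ⊥ < M.J 0 π

/-- `π` is an optimal solution of the constrained problem. -/
def IsOptimal (M : CMDP S A m) (d : Fin m → ℝ) (π : M.Policy) : Prop :=
  M.Feasible d π ∧ ∀ π' : M.Policy, M.Feasible d π' → M.J 0 π' ≤ M.J 0 π

/-- Measurable weight function `w ≥ 1` with `r_i(s, a) ≤ w(s)` on `K`. -/
structure BoundedAboveBy (M : CMDP S A m) (w : S → ℝ) : Prop where
  measurable : Measurable w
  one_le : ∀ s, 1 ≤ w s
  r_le : ∀ (i : Fin (m + 1)) (x : M.K), M.r i x ≤ (w x.1.1 : EReal)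

/-- The tails of the discounted sums of `w` are small uniformly in the policies, and at each time
`w` is uniformly integrable with respect to the policies. -/
structure UniformlySmallTails (M : CMDP S A m) (w : S → ℝ) : Prop where
  tail : Tendsto (fun n : ℕ => ⨆ π : M.Policy, ∫⁻ ω, ∑' k : ℕ,
      M.discount (n + k) * ENNReal.ofReal (w (M.state (n + k) ω)) ∂(M.strategicMeasure π))
    atTop (𝓝 0)
  unifIntegrable : ∀ n : ℕ, Tendsto (fun l : ℕ => ⨆ π : M.Policy,
      ∫⁻ ω, {s : S | (l : ℝ) ≤ w s}.indicator (fun s => ENNReal.ofReal (w s)) (M.state n ω)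
        ∂(M.strategicMeasure π))
    atTop (𝓝 0)

/-- The weak continuity conditions. -/
structure WeaklyContinuous [TopologicalSpace S] [TopologicalSpace A] (M : CMDP S A m) : Prop where
  isCompact_actions : ∀ s, IsCompact (M.actions s)
  upperSemicontinuous_actions :
    ∀ B : Set A, IsClosed B → IsClosed {s : S | (M.actions s ∩ B).Nonempty}
  continuous_p : ∀ v : S → ℝ, Continuous v → (∃ C, ∀ t, |v t| ≤ C) →
    Continuous fun x : M.K => ∫ t, v t ∂(M.p x)
  upperSemicontinuous_r : ∀ i, UpperSemicontinuous (M.r i)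

/-- The setwise continuity conditions. -/
structure SetwiseContinuous [TopologicalSpace A] (M : CMDP S A m) : Prop where
  isCompact_actions : ∀ s, IsCompact (M.actions s)
  continuous_p : ∀ (s : S) (D : Set S), MeasurableSet D →
    Continuous fun a : M.actions s => M.p ⟨(s, a), a.2⟩ D
  upperSemicontinuous_r : ∀ (i : Fin (m + 1)) (s : S),
    UpperSemicontinuous fun a : M.actions s => M.r i ⟨(s, a), a.2⟩

end

end CMDP

/-! Each `J i` depends on a policy only through its discounted occupation measure, against which it
integrates the positive and negative parts of `r i`. If laws of state-action pairs at successive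
times start from the initial distribution and match the transition law, their discounted sum is a
finite measure satisfying a balance equation. Disintegrating this measure over states yields a
stationary policy, and since the equation contracts by the discount factor once the kernel is fixed,
the measure is the occupation measure of that policy (`exists_stationaryPolicy_occupation_eq`). So
it suffices to produce good limit laws; no limit policy is needed.

In the weakly continuous case, take a feasible sequence maximizing `J 0`. The pairs are embedded in
a compact space, where a subsequence of their laws converges at every time. Convergence of the state
marginals, obtained by induction on time, and compactness of the action sets prevent mass from
escaping the graph (`exists_subseq_tendsto_stageProbability`). Uniform integrability of `w` makes
each `J i` upper semicontinuous along such limits (`le_J_of_tendsto_stageProbability`), so the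
constraints and the optimal value survive.

The setwise case reduces to the weak one: the problem involves only the Borel structure of the
states, so their topology may be replaced by another with the same Borel sets. The Kunugui-Novikov
theorem writes each relevant set of pairs with a countable union of rectangles having Borel base and
open side. It is enough to make countably many bases open, with the family closed so that transition
probabilities of its members are again controlled
(`SetwiseContinuous.exists_topology_weaklyContinuous`). -/

/-! ### Novikov separation and the Kunugui-Novikov theorem -/

/-- A sequence of sets is jointly separable if the sets are contained in measurable sets
with empty intersection. -/
def JointlySeparable {α : Type*} [MeasurableSpace α] (P : ℕ → Set α) : Prop :=
  ∃ T : ℕ → Set α, (∀ n, MeasurableSet (T n)) ∧ (∀ n, P n ⊆ T n) ∧ ⋂ n, T n = ∅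

/-- Take unions of the separating sets at the index `k` and intersections at all others: a point
common to all of them would lie in every separating set of a single `i`. Read contrapositively, when
one set is cut into countably many pieces, some piece inherits non-separability. -/
theorem JointlySeparable.of_subset_iUnion {α : Type*} [MeasurableSpace α] {P : ℕ → Set α}
    {P' : ℕ → ℕ → Set α} (k : ℕ) (hk : P k ⊆ ⋃ i, P' i k) (hne : ∀ n i, n ≠ k → P n ⊆ P' i n)
    (h : ∀ i, JointlySeparable (P' i)) : JointlySeparable P := by
  choose T hT hPT hinter using h
  refine ⟨fun n => if n = k then ⋃ i, T i n else ⋂ i, T i n, fun n => ?_, fun n => ?_, ?_⟩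
  · dsimp only
    split_ifs
    · exact MeasurableSet.iUnion fun i => hT i n
    · exact MeasurableSet.iInter fun i => hT i n
  · dsimp only
    split_ifs with hn
    · subst hn
      exact hk.trans (Set.iUnion_mono fun i => hPT i n)
    · exact Set.subset_iInter fun i => (hne n i hn).trans (hPT i n)
  · rw [Set.eq_empty_iff_forall_notMem]
    intro x hx
    rw [Set.mem_iInter] at hx
    have hxk := hx k
    simp only [if_true, Set.mem_iUnion] at hxk
    obtain ⟨i, hi⟩ := hxk
    have : x ∈ ⋂ n, T i n := by
      rw [Set.mem_iInter]
      intro n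
      by_cases hn : n = k
      · rw [hn]; exact hi
      · have := hx n
        rw [if_neg hn, Set.mem_iInter] at this
        exact this i
    rw [hinter i] at this
    exact this

-- If separation failed, it would fail on the images of ever smaller cylinders around some code `z`.
-- The points coded by `z` cannot all coincide, so two of them have disjoint open neighbourhoods,
-- which by continuity already separate the images of a small cylinder.
open PiNat in
theorem jointlySeparable_range {α : Type*} [TopologicalSpace α] [T2Space α] [MeasurableSpace α]
    [OpensMeasurableSpace α] {f : ℕ → (ℕ → ℕ) → α} (hf : ∀ n, Continuous (f n))
    (h : ⋂ n, Set.range (f n) = ∅) : JointlySeparable fun n => Set.range (f n) := by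
  by_contra hsep
  -- All the codes of points of the sets `range (f n)` are interleaved in a single sequence.
  set g : ℕ → (ℕ → ℕ) → α := fun n z => f n fun j => z (Nat.pair n j) with hg
  have hgc : ∀ n, Continuous (g n) := fun n => (hf n).comp (by fun_prop)
  have hgr : ∀ n, Set.range (g n) = Set.range (f n) := by
    intro n
    apply Set.Subset.antisymm
    · rintro _ ⟨z, rfl⟩
      exact ⟨_, rfl⟩
    · rintro _ ⟨x, rfl⟩
      exact ⟨fun i => x (Nat.unpair i).2, by simp [hg]⟩
  have step : ∀ (k : ℕ) (z : ℕ → ℕ), ¬ JointlySeparable (fun n => g n '' cylinder z k) →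
      ∃ i, ¬ JointlySeparable (fun n => g n '' cylinder (Function.update z k i) (k + 1)) := by
    intro k z
    contrapose!
    intro H
    -- Coordinate `k` of the interleaved code is read only by the set with index `(Nat.unpair k).1`;
    -- fixing it cuts this set alone.
    refine JointlySeparable.of_subset_iUnion (Nat.unpair k).1 ?_ ?_ H
    · rw [← iUnion_cylinder_update z k, Set.image_iUnion]
    · rintro n i hn _ ⟨z', hz', rfl⟩
      refine ⟨Function.update z' k i, fun j hj => ?_, ?_⟩
      · rcases eq_or_ne j k with rfl | hjk
        · simp
        · rw [Function.update_of_ne hjk, Function.update_of_ne hjk]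
          exact hz' j (by omega)
      · simp only [hg]
        congr 1
        ext j
        rw [Function.update_of_ne]
        rintro rfl
        simp at hn
  choose! F hF using step
  let zs : ℕ → ℕ → ℕ := fun k => Nat.rec (fun _ => 0) (fun k z => Function.update z k (F k z)) k
  have zs_succ : ∀ k, zs (k + 1) = Function.update (zs k) k (F k (zs k)) := fun k => rfl
  have hzs : ∀ k, ¬ JointlySeparable (fun n => g n '' cylinder (zs k) k) := by
    intro k
    induction k with
    | zero => simpa [hgr] using hsep
    | succ k ih => exact hF k _ ih
  set z : ℕ → ℕ := fun k => zs (k + 1) k with hz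
  have hstab : ∀ k j, j < k → zs k j = z j := by
    intro k
    induction k with
    | zero => intro j hj; omega
    | succ k ih =>
      intro j hj
      rcases eq_or_ne j k with rfl | hjk
      · rfl
      · rw [zs_succ, Function.update_of_ne hjk, ih j (by omega)]
  have hcyl : ∀ k, cylinder (zs k) k = cylinder z k := fun k =>
    mem_cylinder_iff_eq.1 fun j hj => hstab k j hj
  obtain ⟨i, hi⟩ : ∃ i, g i z ≠ g 0 z := by
    by_contra! hall
    have : g 0 z ∈ ⋂ n, Set.range (f n) :=
      Set.mem_iInter.2 fun n => by rw [← hgr, ← hall n]; exact Set.mem_range_self z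
    rw [h] at this
    exact this
  obtain ⟨u, v, hu, hv, hiu, h0v, huv⟩ := t2_separation hi
  obtain ⟨k, hku, hkv⟩ : ∃ k, cylinder z k ⊆ g i ⁻¹' u ∧ cylinder z k ⊆ g 0 ⁻¹' v := by
    have hmem : g i ⁻¹' u ∩ g 0 ⁻¹' v ∈ 𝓝 z :=
      (((hu.preimage (hgc i)).inter (hv.preimage (hgc 0)))).mem_nhds ⟨hiu, h0v⟩
    let := PiNat.metricSpaceNatNat
    obtain ⟨ε, hε, hball⟩ := Metric.mem_nhds_iff.1 hmem
    obtain ⟨k, hk⟩ := exists_pow_lt_of_lt_one hε (by norm_num : (1 / 2 : ℝ) < 1)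
    have hsub : cylinder z k ⊆ Metric.ball z ε := fun y hy =>
      (PiNat.mem_cylinder_iff_dist_le.1 hy).trans_lt hk
    exact ⟨k, fun y hy => (hball (hsub hy)).1, fun y hy => (hball (hsub hy)).2⟩
  apply hzs k
  rw [hcyl]
  refine ⟨fun n => if n = i then u else if n = 0 then v else Set.univ, fun n => ?_, fun n => ?_, ?_⟩
  · dsimp only
    split_ifs
    exacts [hu.measurableSet, hv.measurableSet, MeasurableSet.univ]
  · dsimp only
    split_ifs with h1 h2
    · rw [h1]; exact Set.image_subset_iff.2 hku
    · rw [h2]; exact Set.image_subset_iff.2 hkv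
    · exact Set.subset_univ _
  · rw [Set.eq_empty_iff_forall_notMem]
    intro x hx
    rw [Set.mem_iInter] at hx
    have h1 := hx i
    have h2 := hx 0
    have hi0 : (0 : ℕ) ≠ i := by rintro rfl; exact hi rfl
    simp only [if_true] at h1
    rw [if_neg hi0, if_pos rfl] at h2
    exact Set.disjoint_left.1 huv h1 h2

/-- Novikov's separation theorem. -/
theorem jointlySeparable_of_analyticSet {α : Type*} [TopologicalSpace α] [T2Space α]
    [MeasurableSpace α] [OpensMeasurableSpace α] {P : ℕ → Set α} (hP : ∀ n, AnalyticSet (P n))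
    (h : ⋂ n, P n = ∅) : JointlySeparable P := by
  by_cases hne : ∃ k, P k = ∅
  · obtain ⟨k, hk⟩ := hne
    refine ⟨fun n => if n = k then ∅ else Set.univ, fun n => ?_, fun n => ?_, ?_⟩
    · dsimp only
      split_ifs <;> simp
    · dsimp only
      split_ifs with hn
      · rw [hn, hk]
      · exact Set.subset_univ _
    · rw [Set.eq_empty_iff_forall_notMem]
      intro x hx
      have := Set.mem_iInter.1 hx k
      simp at this
  · push Not at hne
    have : ∀ n, ∃ f : (ℕ → ℕ) → α, Continuous f ∧ Set.range f = P n := fun n => by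
      have := hP n
      rw [AnalyticSet] at this
      exact this.resolve_left (hne n).ne_empty
    choose f hf hfP using this
    have := jointlySeparable_range hf (by simpa only [hfP] using h)
    simpa only [hfP] using this

/-- The Kunugui-Novikov theorem: the complement of a Borel set with closed sections is a countable
union of rectangles with measurable base and open sides. -/
theorem exists_compl_eq_iUnion_prod_of_isClosed_sections {X Y : Type*} [MeasurableSpace X]
    [StandardBorelSpace X] [TopologicalSpace Y] [PolishSpace Y] [MeasurableSpace Y] [BorelSpace Y]
    {C : Set (X × Y)} (hC : MeasurableSet C) (hsec : ∀ x, IsClosed (Prod.mk x ⁻¹' C)) :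
    ∃ (B : ℕ → Set X) (U : ℕ → Set Y), (∀ n, MeasurableSet (B n)) ∧ (∀ n, IsOpen (U n)) ∧
      Cᶜ = ⋃ n, B n ×ˢ U n := by
  let := upgradeStandardBorel X
  obtain ⟨b, hbc, -, hb⟩ := TopologicalSpace.exists_countable_basis Y
  obtain ⟨U, hU⟩ : ∃ U : ℕ → Set Y, b ∪ {∅} = Set.range U :=
    (hbc.union (Set.countable_singleton ∅)).exists_eq_range (by simp)
  have hUo : ∀ n, IsOpen (U n) := by
    intro n
    have : U n ∈ b ∪ {∅} := hU ▸ Set.mem_range_self n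
    rcases this with h | h
    · exact hb.isOpen h
    · rw [Set.mem_singleton_iff.1 h]; exact isOpen_empty
  -- `N n` consists of the base points whose section of `C` meets `U n`. It is only analytic, so its
  -- complement cannot serve directly as the base of a rectangle.
  set N : ℕ → Set X := fun n => Prod.fst '' (C ∩ Prod.snd ⁻¹' U n) with hN
  have hCU : ∀ n, MeasurableSet (C ∩ Prod.snd ⁻¹' U n) := fun n =>
    hC.inter (measurable_snd (hUo n).measurableSet)
  have hNa : ∀ n, AnalyticSet (N n) := fun n => (hCU n).analyticSet_image measurable_fst
  have hPa : ∀ n, AnalyticSet (Cᶜ ∩ (Prod.fst ⁻¹' N n ∪ Prod.snd ⁻¹' (U n)ᶜ)) := by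
    intro n
    have h1 : AnalyticSet ((fun q : X × Y × Y => (q.1, q.2.1)) ''
        {q | (q.1, q.2.1) ∈ Cᶜ ∧ (q.1, q.2.2) ∈ C ∩ Prod.snd ⁻¹' U n}) := by
      refine MeasurableSet.analyticSet_image (MeasurableSet.inter ?_ ?_) (by fun_prop)
      · exact hC.compl.preimage (by fun_prop : Measurable fun q : X × Y × Y => (q.1, q.2.1))
      · exact (hCU n).preimage (by fun_prop : Measurable fun q : X × Y × Y => (q.1, q.2.2))
    have h2 : AnalyticSet (Cᶜ ∩ Prod.snd ⁻¹' (U n)ᶜ) :=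
      (hC.compl.inter (measurable_snd (hUo n).measurableSet.compl)).analyticSet
    have h3 := AnalyticSet.iUnion (s := fun i : Bool => cond i _ _) (fun i => by
      cases i
      exacts [h1, h2])
    convert! h3 using 1
    ext ⟨x, y⟩
    simp only [hN, Set.mem_inter_iff, Set.mem_compl_iff, Set.mem_union, Set.mem_preimage,
      Set.mem_image, Set.mem_iUnion, Bool.exists_bool, cond_true, cond_false, Set.mem_ofPred_eq,
      Prod.exists, Prod.mk.injEq]
    grind
  -- A point off `C` has a basic neighbourhood `U n` missing the closed section, and then it is
  -- outside the `n`-th set; hence the intersection is empty.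
  obtain ⟨T, hT, hPT, hTi⟩ := jointlySeparable_of_analyticSet hPa (by
    rw [Set.eq_empty_iff_forall_notMem]
    rintro ⟨x, y⟩ hxy
    rw [Set.mem_iInter] at hxy
    have hy : y ∈ (Prod.mk x ⁻¹' C)ᶜ := (hxy 0).1
    obtain ⟨V, hV, hyV, hVC⟩ := hb.exists_subset_of_mem_open hy (hsec x).isOpen_compl
    obtain ⟨n, rfl⟩ : V ∈ Set.range U := hU ▸ Or.inl hV
    rcases (hxy n).2 with h | h
    · obtain ⟨⟨x', y'⟩, ⟨h1, h2⟩, rfl⟩ := h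
      exact hVC h2 h1
    · exact h hyV)
  -- Off `C` and `T n`, points have `x ∉ N n` and `y ∈ U n`. Projecting this Borel set gives an
  -- analytic set disjoint from `N n`, and Lusin separation provides the Borel base.
  have hsep : ∀ n, MeasurablySeparable (Prod.fst '' (Cᶜ \ T n)) (N n) := fun n => by
    refine AnalyticSet.measurablySeparable
      ((hC.compl.diff (hT n)).analyticSet_image measurable_fst) (hNa n) ?_
    rw [Set.disjoint_left]
    rintro _ ⟨⟨x, y⟩, ⟨hxC, hxT⟩, rfl⟩ hx
    exact hxT (hPT n ⟨hxC, Or.inl hx⟩)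
  choose B hB hNB hBm using hsep
  refine ⟨B, U, hBm, hUo, ?_⟩
  apply Set.Subset.antisymm
  · rintro ⟨x, y⟩ hxy
    have : (x, y) ∉ ⋂ n, T n := by rw [hTi]; exact fun h => h
    rw [Set.mem_iInter, not_forall] at this
    obtain ⟨n, hn⟩ := this
    refine Set.mem_iUnion.2 ⟨n, hB n ⟨_, ⟨hxy, hn⟩, rfl⟩, ?_⟩
    by_contra hyU
    exact hn (hPT n ⟨hxy, Or.inr hyU⟩)
  · rintro ⟨x, y⟩ hxy hC'
    obtain ⟨n, hxn, hyn⟩ := Set.mem_iUnion.1 hxy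
    exact Set.disjoint_left.1 (hNB n) ⟨(x, y), ⟨hC', hyn⟩, rfl⟩ hxn

/-! ### Stage laws, occupation measures and stationary policies -/

namespace CMDP

noncomputable section

section StageLaw

variable {S : Type u} {A : Type v} [MeasurableSpace S] [MeasurableSpace A] {m : ℕ}

/-- The law of the state-action pair at time `n`. -/
def stageLaw (M : CMDP S A m) (π : M.Policy) (n : ℕ) : Measure M.K :=
  (M.strategicMeasure π).map fun ω => ω n

/-- The discounted occupation measure of a policy. -/
def occupation (M : CMDP S A m) (π : M.Policy) : Measure M.K :=
  Measure.sum fun n => M.discount n • M.stageLaw π n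

/-- The law of the next state if the present state-action pair has law `ν`. -/
def nextState (M : CMDP S A m) (ν : Measure M.K) : Measure S := M.p ∘ₘ ν

/-- The law of the state if the state-action pair has law `ν`. -/
def stateMarginal (M : CMDP S A m) (ν : Measure M.K) : Measure S := ν.map fun x => x.1.1

variable (M : CMDP S A m) (π : M.Policy)

theorem measurable_fst_coe : Measurable fun x : M.K => x.1.1 :=
  measurable_fst.comp measurable_subtype_coe

instance isProbabilityMeasure_strategicMeasure : IsProbabilityMeasure (M.strategicMeasure π) := by
  unfold strategicMeasure
  have : IsProbabilityMeasure ((M.stepKernel π 0 Fin.elim0).map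
      (fun x (_ : Finset.Iic 0) => x)) :=
    Measure.isProbabilityMeasure_map (by fun_prop)
  infer_instance

instance isProbabilityMeasure_stageLaw (n : ℕ) : IsProbabilityMeasure (M.stageLaw π n) :=
  Measure.isProbabilityMeasure_map (measurable_pi_apply n).aemeasurable

theorem stepKernel_apply {n : ℕ} (x : Fin n → M.K) {B : Set M.K} (hB : MeasurableSet B) :
    M.stepKernel π n x B = M.pairKernel π n x (Subtype.val '' B) := by
  rw [stepKernel, Kernel.comapRight_apply' _ _ _ hB]

theorem stepKernel_fst {n : ℕ} (x : Fin n → M.K) {D : Set S} (hD : MeasurableSet D) :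
    M.stepKernel π n x ((fun x => x.1.1) ⁻¹' D) = M.stateKernel n x D := by
  have := π.isMarkovKernel n
  rw [stepKernel_apply _ _ _ (M.measurable_fst_coe hD)]
  have h : (Subtype.val '' ((fun x : M.K => x.1.1) ⁻¹' D)) = Prod.fst ⁻¹' D ∩ M.K := by
    ext y
    simp [and_comm]
  have : IsProbabilityMeasure (M.pairKernel π n x) := by unfold pairKernel; infer_instance
  have hK : M.pairKernel π n x M.Kᶜ = 0 :=
    (prob_compl_eq_zero_iff M.measurableSet_K).2 (M.pairKernel_K π n x)
  rw [h, measure_inter_conull hK]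
  have hfst := Kernel.fst_apply' (M.pairKernel π n) x hD
  rw [pairKernel, Kernel.fst_compProd] at hfst
  exact hfst.symm

/-- The law of the first `n + 1` state-action pairs. -/
def historyLaw (n : ℕ) : Measure ((i : Finset.Iic n) → (fun _ : ℕ => M.K) i) :=
  (M.strategicMeasure π).map (Preorder.frestrictLe n)

theorem historyLaw_eq (n : ℕ) : M.historyLaw π n =
    Kernel.partialTraj (X := fun _ : ℕ => M.K) (M.trajKernel π) 0 n ∘ₘ
      ((M.stepKernel π 0 Fin.elim0).map (fun x (_ : Finset.Iic 0) => x)) := by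
  rw [historyLaw, strategicMeasure, Measure.map_comp _ _ (by fun_prop),
    Kernel.traj_map_frestrictLe]

theorem stageLaw_zero : M.stageLaw π 0 = M.stepKernel π 0 Fin.elim0 := by
  have h : (fun ω : ℕ → M.K => ω 0) =
      (fun x : (i : Finset.Iic 0) → (fun _ : ℕ => M.K) i => x ⟨0, by simp⟩) ∘
        Preorder.frestrictLe 0 := rfl
  rw [stageLaw, h, ← Measure.map_map (by fun_prop) (by fun_prop), ← historyLaw, historyLaw_eq,
    Kernel.partialTraj_self, Measure.id_comp, Measure.map_map (by fun_prop) (by fun_prop)]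
  exact Measure.map_id

theorem stageLaw_succ (n : ℕ) :
    M.stageLaw π (n + 1) = M.trajKernel π n ∘ₘ M.historyLaw π n := by
  rw [historyLaw_eq, Measure.comp_assoc, stageLaw, strategicMeasure,
    Measure.map_comp _ _ (by fun_prop), ← Kernel.traj_comp_partialTraj (Nat.zero_le n),
    Kernel.map_comp, Kernel.map_traj_succ_self]

theorem stageLaw_eq_map_historyLaw (n : ℕ) :
    M.stageLaw π n = (M.historyLaw π n).map fun x => x ⟨n, by simp⟩ := by
  rw [historyLaw, Measure.map_map (by fun_prop) (by fun_prop)]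
  rfl

theorem stateMarginal_stageLaw_zero : M.stateMarginal (M.stageLaw π 0) = M.μ := by
  ext D hD
  rw [stateMarginal, Measure.map_apply M.measurable_fst_coe hD, stageLaw_zero,
    stepKernel_fst _ _ _ hD]
  simp [stateKernel]

/-- Decision rules have mass one on the feasible actions and drop out of the state marginal. The
resulting relation does not mention the policy, so it can be passed to limits of stage laws. -/
theorem stateMarginal_stageLaw_succ (n : ℕ) :
    M.stateMarginal (M.stageLaw π (n + 1)) = M.nextState (M.stageLaw π n) := by
  ext D hD
  have hD' := M.measurable_fst_coe hD
  rw [stateMarginal, Measure.map_apply M.measurable_fst_coe hD, stageLaw_succ, nextState,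
    Measure.bind_apply hD' (Kernel.aemeasurable _), Measure.bind_apply hD (Kernel.aemeasurable _),
    stageLaw_eq_map_historyLaw, lintegral_map (Kernel.measurable_coe _ hD) (by fun_prop)]
  congr 1 with x
  rw [trajKernel, Kernel.comap_apply, stepKernel_fst _ _ _ hD]
  simp only [stateKernel, Kernel.comap_apply]
  rfl

theorem lintegral_occupation (g : M.K → ℝ≥0∞) :
    ∫⁻ x, g x ∂(M.occupation π) = ∑' n, M.discount n * ∫⁻ x, g x ∂(M.stageLaw π n) := by
  simp [occupation, lintegral_sum_measure, lintegral_smul_measure]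

theorem lintegral_occupation_eq_strategicMeasure {g : M.K → ℝ≥0∞} (hg : Measurable g) :
    ∫⁻ x, g x ∂(M.occupation π) =
      ∫⁻ ω, ∑' n, M.discount n * g (ω n) ∂(M.strategicMeasure π) := by
  have hg' : ∀ n, Measurable fun ω : ℕ → M.K => g (ω n) := fun n => hg.comp (measurable_pi_apply n)
  rw [lintegral_occupation, lintegral_tsum fun n => ((hg' n).const_mul _).aemeasurable]
  congr 1 with n
  rw [lintegral_const_mul _ (hg' n), stageLaw, lintegral_map hg (measurable_pi_apply n)]

theorem Jpos_eq (i : Fin (m + 1)) :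
    M.Jpos i π = ∫⁻ x, (M.r i x).toENNReal ∂(M.occupation π) := by
  rw [lintegral_occupation_eq_strategicMeasure _ _ (M.measurable_r i).ereal_toENNReal, Jpos]

theorem Jneg_eq (i : Fin (m + 1)) :
    M.Jneg i π = ∫⁻ x, (-(M.r i x)).toENNReal ∂(M.occupation π) := by
  rw [lintegral_occupation_eq_strategicMeasure _ _
    (g := fun x => (-(M.r i x)).toENNReal) (M.measurable_r i).neg.ereal_toENNReal, Jneg]

theorem discount_succ (n : ℕ) : M.discount (n + 1) = ENNReal.ofReal M.β * M.discount n := by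
  rw [discount, discount, pow_succ', ENNReal.ofReal_mul M.β_pos.le]

theorem discount_eq_pow (n : ℕ) : M.discount n = ENNReal.ofReal M.β ^ n := by
  rw [discount, ENNReal.ofReal_pow M.β_pos.le]

theorem ofReal_β_lt_one : ENNReal.ofReal M.β < 1 := by
  rw [ENNReal.ofReal_lt_one]
  exact M.β_lt_one

theorem tsum_discount_ne_top : ∑' n, M.discount n ≠ ∞ := by
  simp_rw [discount_eq_pow, ENNReal.tsum_geometric]
  exact ENNReal.inv_ne_top.2 (tsub_pos_of_lt M.ofReal_β_lt_one).ne'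

/-- The kernel from states to feasible state-action pairs given by a stationary policy. -/
def actionKernel {M : CMDP S A m} (φ : M.StationaryPolicy) : Kernel S M.K :=
  (Kernel.id ×ₖ φ.kernel).comapRight (MeasurableEmbedding.subtype_coe M.measurableSet_K)

variable {M}

theorem actionKernel_apply (φ : M.StationaryPolicy) (s : S) {B : Set M.K} (hB : MeasurableSet B) :
    actionKernel φ s B = φ.kernel s (Prod.mk s ⁻¹' (Subtype.val '' B)) := by
  have := φ.isMarkovKernel
  have hB' := (MeasurableEmbedding.subtype_coe M.measurableSet_K).measurableSet_image.2 hB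
  rw [actionKernel, Kernel.comapRight_apply' _ _ _ hB, Kernel.prod_apply, Kernel.id_apply,
    Measure.dirac_prod, Measure.map_apply (by fun_prop) hB']

instance isMarkovKernel_actionKernel (φ : M.StationaryPolicy) : IsMarkovKernel (actionKernel φ) := by
  refine ⟨fun s => ⟨?_⟩⟩
  rw [actionKernel_apply _ _ MeasurableSet.univ, Set.image_univ, Subtype.range_coe]
  exact φ.feasible s

theorem stepKernel_toPolicy (φ : M.StationaryPolicy) {n : ℕ} (x : Fin n → M.K) :
    M.stepKernel φ.toPolicy n x = actionKernel φ ∘ₘ M.stateKernel n x := by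
  have := φ.isMarkovKernel
  have := φ.toPolicy.isMarkovKernel n
  ext B hB
  have hB' := (MeasurableEmbedding.subtype_coe M.measurableSet_K).measurableSet_image.2 hB
  rw [stepKernel_apply _ _ _ hB, pairKernel, Kernel.compProd_apply hB',
    Measure.bind_apply hB (Kernel.aemeasurable _)]
  congr 1 with s
  rw [actionKernel_apply _ _ hB]
  rfl

theorem stageLaw_toPolicy_zero (φ : M.StationaryPolicy) :
    M.stageLaw φ.toPolicy 0 = actionKernel φ ∘ₘ M.μ := by
  rw [stageLaw_zero, stepKernel_toPolicy]
  rfl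

theorem stageLaw_toPolicy_succ (φ : M.StationaryPolicy) (n : ℕ) :
    M.stageLaw φ.toPolicy (n + 1) =
      actionKernel φ ∘ₘ M.nextState (M.stageLaw φ.toPolicy n) := by
  ext B hB
  rw [stageLaw_succ, nextState, Measure.comp_assoc, Measure.bind_apply hB (Kernel.aemeasurable _),
    Measure.bind_apply hB (Kernel.aemeasurable _), stageLaw_eq_map_historyLaw,
    lintegral_map (Kernel.measurable_coe _ hB) (by fun_prop)]
  congr 1 with x
  rw [trajKernel, Kernel.comap_apply, stepKernel_toPolicy, Kernel.comp_apply]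
  rfl

theorem nextState_add (ν ν' : Measure M.K) :
    M.nextState (ν + ν') = M.nextState ν + M.nextState ν' := by
  ext D hD
  simp [nextState, Measure.bind_apply hD (Kernel.aemeasurable _)]

theorem nextState_smul (c : ℝ≥0∞) (ν : Measure M.K) :
    M.nextState (c • ν) = c • M.nextState ν := by
  ext D hD
  simp [nextState, Measure.bind_apply hD (Kernel.aemeasurable _)]

theorem nextState_univ (ν : Measure M.K) : M.nextState ν Set.univ = ν Set.univ := by
  have := M.isMarkovKernel_p
  simp [nextState, Measure.bind_apply MeasurableSet.univ (Kernel.aemeasurable _)]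

/-- A finite measure which satisfies the balance equation and is disintegrated by a stationary
policy is the occupation measure of this policy. -/
theorem eq_occupation_of_balance (φ : M.StationaryPolicy) {Q : Measure M.K} [IsFiniteMeasure Q]
    (hbal : M.stateMarginal Q = M.μ + ENNReal.ofReal M.β • M.nextState Q)
    (hφ : Q = actionKernel φ ∘ₘ M.stateMarginal Q) : Q = M.occupation φ.toPolicy := by
  have comp_univ : ∀ ν : Measure S, (actionKernel φ ∘ₘ ν) Set.univ = ν Set.univ := fun ν => by
    simp [Measure.bind_apply MeasurableSet.univ (Kernel.aemeasurable _)]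
  have comp_add : ∀ ν ν' : Measure S,
      actionKernel φ ∘ₘ (ν + ν') = actionKernel φ ∘ₘ ν + actionKernel φ ∘ₘ ν' := fun ν ν' => by
    ext B hB
    simp [Measure.bind_apply hB (Kernel.aemeasurable _)]
  have comp_smul : ∀ (c : ℝ≥0∞) (ν : Measure S),
      actionKernel φ ∘ₘ (c • ν) = c • (actionKernel φ ∘ₘ ν) := fun c ν => by
    ext B hB
    simp [Measure.bind_apply hB (Kernel.aemeasurable _)]
  have hQ : Q = M.stageLaw φ.toPolicy 0 +
      ENNReal.ofReal M.β • (actionKernel φ ∘ₘ M.nextState Q) := by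
    conv_lhs => rw [hφ, hbal, comp_add, comp_smul, ← stageLaw_toPolicy_zero]
  set T : Measure M.K → Measure M.K := fun ν => actionKernel φ ∘ₘ M.nextState ν with hT
  have hT_univ : ∀ N : ℕ, (T^[N] Q) Set.univ = Q Set.univ := by
    intro N
    induction N with
    | zero => rfl
    | succ N ih => rw [Function.iterate_succ_apply', hT, comp_univ, nextState_univ, ← hT, ih]
  have hT_stage : ∀ N : ℕ,
      T^[N] Q = M.stageLaw φ.toPolicy N + ENNReal.ofReal M.β • T^[N + 1] Q := by
    intro N
    induction N with
    | zero => exact hQ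
    | succ N ih =>
      conv_lhs => rw [Function.iterate_succ_apply', ih]
      rw [Function.iterate_succ_apply' _ (N + 1)]
      simp only [hT, nextState_add, nextState_smul, comp_add, comp_smul, stageLaw_toPolicy_succ]
  -- Unrolling the fixed-point equation `N` times; the remainder vanishes as `N` grows because `T`
  -- preserves the finite total mass.
  have hsum : ∀ (B : Set M.K) (N : ℕ), Q B =
      ∑ n ∈ Finset.range N, M.discount n * M.stageLaw φ.toPolicy n B
        + M.discount N * T^[N] Q B := by
    intro B N
    induction N with
    | zero => simp [discount]
    | succ N ih =>
      rw [ih, Finset.sum_range_succ, discount_succ, hT_stage N]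
      simp only [Measure.add_apply, Measure.smul_apply, smul_eq_mul]
      ring
  ext B hB
  have h1 : Tendsto (fun N => ∑ n ∈ Finset.range N, M.discount n * M.stageLaw φ.toPolicy n B)
      atTop (𝓝 (∑' n, M.discount n * M.stageLaw φ.toPolicy n B)) :=
    ENNReal.tendsto_nat_tsum _
  have h2 : Tendsto (fun N => M.discount N * T^[N] Q B) atTop (𝓝 0) := by
    have h3 : Tendsto (fun N => M.discount N * Q Set.univ) atTop (𝓝 0) := by
      simp_rw [discount_eq_pow]
      have := ENNReal.Tendsto.mul_const (b := Q Set.univ)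
        (ENNReal.tendsto_pow_atTop_nhds_zero_of_lt_one M.ofReal_β_lt_one)
        (Or.inr (measure_ne_top _ _))
      rwa [zero_mul] at this
    refine tendsto_of_tendsto_of_tendsto_of_le_of_le tendsto_const_nhds h3 (fun _ => zero_le)
      fun N => ?_
    dsimp only
    rw [← hT_univ N]
    gcongr
    exact Set.subset_univ _
  have h4 := h1.add h2
  simp_rw [← hsum B, add_zero] at h4
  rw [tendsto_nhds_unique tendsto_const_nhds h4, occupation, Measure.sum_apply _ hB]
  simp

/-- Every finite measure on the feasible pairs is disintegrated by a stationary policy. -/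
theorem exists_stationaryPolicy_disintegration [StandardBorelSpace A] [Nonempty A] (π : M.Policy)
    (Q : Measure M.K) [IsFiniteMeasure Q] :
    ∃ φ : M.StationaryPolicy, Q = actionKernel φ ∘ₘ M.stateMarginal Q := by
  classical
  set ρ : Measure (S × A) := Q.map Subtype.val with hρ
  have hρfst : ρ.fst = M.stateMarginal Q := by
    rw [hρ, Measure.fst, Measure.map_map measurable_fst measurable_subtype_coe]
    rfl
  have hdis : M.stateMarginal Q ⊗ₘ ρ.condKernel = ρ := by
    rw [← hρfst]
    exact ρ.disintegrate ρ.condKernel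
  have : IsFiniteMeasure (M.stateMarginal Q) := by rw [← hρfst]; infer_instance
  set G : Set S := {s | ρ.condKernel s (Prod.mk s ⁻¹' M.K) = 1} with hG
  have hGm : MeasurableSet G :=
    (Kernel.measurable_kernel_prodMk_left M.measurableSet_K) (measurableSet_singleton 1)
  have hGae : ∀ᵐ s ∂(M.stateMarginal Q), s ∈ G := by
    have h1 : ρ M.Kᶜ = 0 := by
      rw [hρ, Measure.map_apply measurable_subtype_coe M.measurableSet_K.compl]
      have : (Subtype.val ⁻¹' M.Kᶜ : Set M.K) = ∅ := by ext x; simp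
      rw [this, measure_empty]
    rw [← hdis, Measure.compProd_apply M.measurableSet_K.compl, lintegral_eq_zero_iff
      (Kernel.measurable_kernel_prodMk_left M.measurableSet_K.compl)] at h1
    filter_upwards [h1] with s hs
    rw [hG, Set.mem_ofPred_eq, ← prob_compl_eq_zero_iff
      (measurable_prodMk_left M.measurableSet_K)]
    exact hs
  have := π.isMarkovKernel 0
  -- On the null set where the conditional kernel may charge infeasible actions, it is replaced by
  -- the first decision rule of the given policy, which spares a measurable selection.
  set k0 : Kernel S A := (π.kernel 0).comap (fun s => (Fin.elim0, s)) (by fun_prop) with hk0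
  let φ : M.StationaryPolicy :=
    { kernel := Kernel.piecewise hGm ρ.condKernel k0
      isMarkovKernel := inferInstance
      feasible := fun s => by
        rw [Kernel.piecewise_apply]
        split_ifs with hs
        · exact hs
        · exact π.feasible 0 (Fin.elim0, s) }
  refine ⟨φ, ?_⟩
  ext B hB
  have hB' := (MeasurableEmbedding.subtype_coe M.measurableSet_K).measurableSet_image.2 hB
  have h1 : Q B = ρ (Subtype.val '' B) := by
    rw [hρ, Measure.map_apply measurable_subtype_coe hB',
      Set.preimage_image_eq _ Subtype.val_injective]
  rw [h1, ← hdis, Measure.compProd_apply hB', Measure.bind_apply hB (Kernel.aemeasurable _)]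
  refine lintegral_congr_ae ?_
  filter_upwards [hGae] with s hs
  rw [actionKernel_apply _ _ hB]
  change _ = Kernel.piecewise hGm ρ.condKernel k0 s _
  rw [Kernel.piecewise_apply, if_pos hs]

/-- Laws of state-action pairs that are consistent with the transition law have the same
discounted occupation measure as some stationary policy. -/
theorem exists_stationaryPolicy_occupation_eq [StandardBorelSpace A] [Nonempty A] (π : M.Policy)
    (ν : ℕ → Measure M.K) [∀ n, IsProbabilityMeasure (ν n)] (h0 : M.stateMarginal (ν 0) = M.μ)
    (hsucc : ∀ n, M.stateMarginal (ν (n + 1)) = M.nextState (ν n)) :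
    ∃ φ : M.StationaryPolicy,
      M.occupation φ.toPolicy = Measure.sum fun n => M.discount n • ν n := by
  set Q : Measure M.K := Measure.sum fun n => M.discount n • ν n with hQ
  have : IsFiniteMeasure Q := ⟨by
    rw [hQ, Measure.sum_apply _ MeasurableSet.univ]
    simpa using M.tsum_discount_ne_top.lt_top⟩
  obtain ⟨φ, hφ⟩ := exists_stationaryPolicy_disintegration π Q
  refine ⟨φ, (eq_occupation_of_balance φ ?_ hφ).symm⟩
  ext D hD
  have hD' := M.measurable_fst_coe hD
  have h1 : ∀ n, ν n ((fun x => x.1.1) ⁻¹' D) = M.stateMarginal (ν n) D := fun n => by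
    rw [stateMarginal, Measure.map_apply M.measurable_fst_coe hD]
  -- In the balance equation the term at time zero yields the initial distribution, and the shifted
  -- remainder yields the discounted next-state law.
  rw [stateMarginal, Measure.map_apply M.measurable_fst_coe hD, hQ, Measure.sum_apply _ hD',
    Measure.add_apply, Measure.smul_apply, nextState, Measure.bind_apply hD (Kernel.aemeasurable _),
    lintegral_sum_measure, tsum_eq_zero_add' ENNReal.summable]
  simp only [Measure.smul_apply, smul_eq_mul, h1, h0, hsucc, lintegral_smul_measure,
    discount_succ, mul_assoc, ENNReal.tsum_mul_left]
  congr 1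
  · simp [discount]
  · congr 2 with n
    rw [nextState, Measure.bind_apply hD (Kernel.aemeasurable _)]

end StageLaw

end

end CMDP

/-! ### Weak convergence and compactness of stage laws -/

/-- Superlevel sets of `f` are open, so the layer-cake formula and Fatou's lemma in the level give
the inequality. Truncating at `j` first keeps the values finite, and monotone convergence removes
the truncation. -/
theorem lintegral_le_liminf_lintegral_of_lowerSemicontinuous {Ω : Type*} [MeasurableSpace Ω]
    [TopologicalSpace Ω] [OpensMeasurableSpace Ω] {ν : Measure Ω} {νs : ℕ → Measure Ω}
    {f : Ω → ℝ≥0∞} (hf : LowerSemicontinuous f)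
    (hopen : ∀ G, IsOpen G → ν G ≤ liminf (fun k => νs k G) atTop) :
    ∫⁻ x, f x ∂ν ≤ liminf (fun k => ∫⁻ x, f x ∂(νs k)) atTop := by
  have key : ∀ j : ℕ, ∫⁻ x, min (f x) j ∂ν ≤ liminf (fun k => ∫⁻ x, f x ∂(νs k)) atTop := by
    intro j
    have hne : ∀ x, min (f x) (j : ℝ≥0∞) ≠ ∞ := fun x =>
      ((min_le_right _ _).trans_lt (ENNReal.natCast_lt_top j)).ne
    have hreal : ∀ ρ : Measure Ω, ∫⁻ x, min (f x) (j : ℝ≥0∞) ∂ρ =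
        ∫⁻ t in Set.Ioi (0 : ℝ), ρ {x | t < (min (f x) (j : ℝ≥0∞)).toReal} := fun ρ => by
      rw [← lintegral_eq_lintegral_meas_lt ρ (Eventually.of_forall fun x => ENNReal.toReal_nonneg)
        (hf.measurable.min measurable_const).ennreal_toReal.aemeasurable]
      congr 1 with x
      rw [ENNReal.ofReal_toReal (hne x)]
    have hset : ∀ t ∈ Set.Ioi (0 : ℝ), IsOpen {x | t < (min (f x) (j : ℝ≥0∞)).toReal} := by
      intro t ht
      have : {x | t < (min (f x) (j : ℝ≥0∞)).toReal} =
          f ⁻¹' Set.Ioi (ENNReal.ofReal t) ∩ {_x | ENNReal.ofReal t < (j : ℝ≥0∞)} := by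
        ext x
        simp [← ENNReal.ofReal_lt_iff_lt_toReal (le_of_lt ht) (hne x)]
      rw [this]
      exact (lowerSemicontinuous_iff_isOpen_preimage.1 hf _).inter isOpen_const
    calc ∫⁻ x, min (f x) (j : ℝ≥0∞) ∂ν
        = ∫⁻ t in Set.Ioi (0 : ℝ), ν {x | t < (min (f x) (j : ℝ≥0∞)).toReal} := hreal ν
      _ ≤ ∫⁻ t in Set.Ioi (0 : ℝ),
            liminf (fun k => νs k {x | t < (min (f x) (j : ℝ≥0∞)).toReal}) atTop :=
          setLIntegral_mono' measurableSet_Ioi fun t ht => hopen _ (hset t ht)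
      _ ≤ liminf (fun k => ∫⁻ t in Set.Ioi (0 : ℝ),
            νs k {x | t < (min (f x) (j : ℝ≥0∞)).toReal}) atTop :=
          lintegral_liminf_le fun k => Antitone.measurable fun s t hst =>
            measure_mono fun x hx => lt_of_le_of_lt hst hx
      _ = liminf (fun k => ∫⁻ x, min (f x) (j : ℝ≥0∞) ∂(νs k)) atTop := by simp_rw [hreal]
      _ ≤ liminf (fun k => ∫⁻ x, f x ∂(νs k)) atTop :=
          liminf_le_liminf (Eventually.of_forall fun k => lintegral_mono fun x => min_le_left _ _)
  have hsup : ∀ x, f x = ⨆ j : ℕ, min (f x) (j : ℝ≥0∞) := fun x => by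
    rw [← inf_iSup_eq, ENNReal.iSup_natCast]
    simp
  calc ∫⁻ x, f x ∂ν = ∫⁻ x, ⨆ j : ℕ, min (f x) (j : ℝ≥0∞) ∂ν := by simp_rw [← hsup]
    _ = ⨆ j : ℕ, ∫⁻ x, min (f x) (j : ℝ≥0∞) ∂ν :=
        lintegral_iSup (fun j => hf.measurable.min measurable_const)
          fun i j hij x => min_le_min le_rfl (Nat.cast_le.2 hij)
    _ ≤ _ := iSup_le key

/-- The composition of a probability measure with a Markov kernel. -/
noncomputable def MeasureTheory.ProbabilityMeasure.compKernel {X Y : Type*} [MeasurableSpace X]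
    [MeasurableSpace Y] (ν : ProbabilityMeasure X) (κ : Kernel X Y) [IsMarkovKernel κ] :
    ProbabilityMeasure Y :=
  ⟨κ ∘ₘ (ν : Measure X), inferInstance⟩

/-- The composition of a measure with a weakly continuous Markov kernel depends continuously
on the measure. -/
theorem tendsto_comp_of_weaklyContinuous {X Y ι : Type*} [MeasurableSpace X] [TopologicalSpace X]
    [OpensMeasurableSpace X] [MeasurableSpace Y] [TopologicalSpace Y] [OpensMeasurableSpace Y]
    {κ : Kernel X Y} [IsMarkovKernel κ]
    (hκ : ∀ v : Y → ℝ, Continuous v → (∃ C, ∀ y, |v y| ≤ C) → Continuous fun x => ∫ y, v y ∂(κ x))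
    {L : Filter ι} {ν : ProbabilityMeasure X} {νs : ι → ProbabilityMeasure X}
    (h : Tendsto νs L (𝓝 ν)) :
    Tendsto (fun i => (νs i).compKernel κ) L (𝓝 (ν.compKernel κ)) := by
  rw [ProbabilityMeasure.tendsto_iff_forall_integral_tendsto] at h ⊢
  intro v
  have hb : ∀ y, ‖v y‖ ≤ ‖v‖ := fun y => v.norm_coe_le_norm y
  have hcont := hκ v v.continuous ⟨_, hb⟩
  let g : BoundedContinuousFunction X ℝ := BoundedContinuousFunction.ofNormedAddCommGroup
    (fun x => ∫ y, v y ∂(κ x)) hcont ‖v‖ fun x => by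
      simpa using norm_integral_le_of_norm_le_const (μ := κ x) (Eventually.of_forall hb)
  have hint : ∀ ρ : ProbabilityMeasure X,
      ∫ y, v y ∂(ρ.compKernel κ : Measure Y) = ∫ x, g x ∂(ρ : Measure X) := by
    intro ρ
    have := Kernel.integral_comp (κ := Kernel.const Unit (ρ : Measure X)) (η := κ) (a := ())
      (f := v) (by
        rw [Kernel.comp_apply]
        exact v.integrable _)
    rw [Kernel.comp_apply, Kernel.const_apply] at this
    exact this
  have := h g
  simp_rw [← hint] at this
  exact this

/-- If the images under an embedding converge weakly to a measure carried by its range, then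
the measures themselves converge weakly. -/
theorem exists_tendsto_of_tendsto_map {X Z : Type*} [MeasurableSpace X] [TopologicalSpace X]
    [BorelSpace X] [MeasurableSpace Z] [TopologicalSpace Z] [BorelSpace Z]
    [HasOuterApproxClosed Z] {e : X → Z} (he : IsEmbedding e) (hem : MeasurableEmbedding e)
    {ν : ℕ → ProbabilityMeasure X} {ρ : ProbabilityMeasure Z}
    (h : Tendsto (fun k => (ν k).map hem.measurable.aemeasurable) atTop (𝓝 ρ))
    (hρ : (ρ : Measure Z) (Set.range e)ᶜ = 0) :
    ∃ ν' : ProbabilityMeasure X, Tendsto ν atTop (𝓝 ν') := by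
  have happly : ∀ G : Set Z, ((ρ : Measure Z).comap e) (e ⁻¹' G) = (ρ : Measure Z) G := by
    intro G
    rw [hem.comap_apply, Set.image_preimage_eq_inter_range, measure_inter_conull hρ]
  refine ⟨⟨(ρ : Measure Z).comap e, ⟨?_⟩⟩, tendsto_of_forall_isOpen_le_liminf_nat' ?_⟩
  · rw [← Set.preimage_univ (f := e), happly, measure_univ]
  · intro U hU
    obtain ⟨G, hG, rfl⟩ := he.isOpen_iff.1 hU
    have := ProbabilityMeasure.le_liminf_measure_open_of_tendsto h hG
    rw [ProbabilityMeasure.coe_mk, happly]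
    refine this.trans_eq ?_
    congr 1 with k
    exact ProbabilityMeasure.map_apply' _ _ hG.measurableSet

/-- The graph of an upper semicontinuous compact-valued correspondence between Borel subsets of
Polish spaces, embedded into a compact space so that the sections remain closed. -/
theorem exists_embedding_of_isCompact_sections {S A : Type*}
    [TopologicalSpace S] [TopologicalSpace.MetrizableSpace S] [SecondCountableTopology S]
    [MeasurableSpace S] [BorelSpace S] [StandardBorelSpace S]
    [TopologicalSpace A] [TopologicalSpace.MetrizableSpace A] [SecondCountableTopology A]
    [MeasurableSpace A] [BorelSpace A] [StandardBorelSpace A]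
    {K : Set (S × A)} (hK : MeasurableSet K) (hcomp : ∀ s, IsCompact {a | (s, a) ∈ K})
    (husc : ∀ B : Set A, IsClosed B → IsClosed {s : S | ({a | (s, a) ∈ K} ∩ B).Nonempty}) :
    ∃ (f : S → ℕ → unitInterval) (e : K → (ℕ → unitInterval) × (ℕ → unitInterval)),
      IsEmbedding f ∧ MeasurableEmbedding f ∧ IsEmbedding e ∧ MeasurableEmbedding e ∧
      (∀ x, (e x).1 = f x.1.1) ∧
      ∀ s z, (f s, z) ∈ closure (Set.range e) → (f s, z) ∈ Set.range e := by
  let := TopologicalSpace.metrizableSpaceMetric S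
  let := TopologicalSpace.metrizableSpaceMetric A
  obtain ⟨f, hf⟩ := Metric.PiNatEmbed.exists_embedding_to_hilbert_cube (X := S)
  obtain ⟨g, hg⟩ := Metric.PiNatEmbed.exists_embedding_to_hilbert_cube (X := A)
  have : StandardBorelSpace K := hK.standardBorel
  have he : IsEmbedding ((Prod.map f g) ∘ (Subtype.val : K → S × A)) :=
    (hf.prodMap hg).comp IsEmbedding.subtypeVal
  refine ⟨f, (Prod.map f g) ∘ Subtype.val, hf,
    hf.continuous.measurable.measurableEmbedding hf.injective, he,
    he.continuous.measurable.measurableEmbedding he.injective, fun x => rfl, fun s z hz => ?_⟩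
  by_contra hnot
  have hz' : z ∉ g '' {a | (s, a) ∈ K} := by
    rintro ⟨a, ha, rfl⟩
    exact hnot ⟨⟨(s, a), ha⟩, rfl⟩
  obtain ⟨V, U, hV, hU, hsV, hzU, hVU⟩ := SeparatedNhds.of_isCompact_isCompact
    ((hcomp s).image hg.continuous) (isCompact_singleton (x := z))
    (Set.disjoint_singleton_right.2 hz')
  -- Upper semicontinuity: for states near `s`, all images of feasible actions stay in `V`. So a
  -- product neighbourhood of `(f s, z)` misses the graph, against `hz`.
  have hO := (husc (g ⁻¹' V)ᶜ (hV.preimage hg.continuous).isClosed_compl).isOpen_compl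
  obtain ⟨O, hO', hOeq⟩ := hf.isOpen_iff.1 hO
  have hsO : f s ∈ O := by
    change s ∈ f ⁻¹' O
    rw [hOeq]
    rintro ⟨a, ha, ha'⟩
    exact ha' (hsV ⟨a, ha, rfl⟩)
  obtain ⟨_, ⟨h1, h2⟩, ⟨⟨⟨s', a'⟩, hK'⟩, rfl⟩⟩ := mem_closure_iff.1 hz (O ×ˢ U) (hO'.prod hU)
    ⟨hsO, hzU rfl⟩
  have h3 : s' ∈ f ⁻¹' O := h1
  rw [hOeq] at h3
  refine h3 ⟨a', hK', fun hV' => ?_⟩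
  exact Set.disjoint_left.1 hVU hV' h2

namespace CMDP

noncomputable section

section Compactness

variable {S : Type u} {A : Type v}
  [TopologicalSpace S] [TopologicalSpace.MetrizableSpace S] [SecondCountableTopology S]
  [MeasurableSpace S] [BorelSpace S] [StandardBorelSpace S]
  [TopologicalSpace A] [TopologicalSpace.MetrizableSpace A] [SecondCountableTopology A]
  [MeasurableSpace A] [BorelSpace A] [StandardBorelSpace A] {m : ℕ}

/-- `stageLaw` as a bundled probability measure. -/
def stageProbability {S : Type u} {A : Type v} [MeasurableSpace S] [MeasurableSpace A]
    (M : CMDP S A m) (π : M.Policy) (n : ℕ) : ProbabilityMeasure M.K :=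
  ⟨M.stageLaw π n, inferInstance⟩

/-- In a weakly continuous model, any sequence of policies has a subsequence along which the laws
of the state-action pairs converge weakly, to laws consistent with the transition law. -/
theorem exists_subseq_tendsto_stageProbability (M : CMDP S A m) (hM : M.WeaklyContinuous)
    (π : ℕ → M.Policy) :
    ∃ σ : ℕ → ℕ, StrictMono σ ∧ ∃ ν : ℕ → ProbabilityMeasure M.K,
      (∀ n, Tendsto (fun k => M.stageProbability (π (σ k)) n) atTop (𝓝 (ν n))) ∧
      M.stateMarginal (ν 0) = M.μ ∧
      ∀ n, M.stateMarginal (ν (n + 1)) = M.nextState (ν n) := by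
  have := M.isMarkovKernel_p
  obtain ⟨f, e, hf, hfm, he, hem, hfe, hcl⟩ := exists_embedding_of_isCompact_sections
    M.measurableSet_K hM.isCompact_actions hM.upperSemicontinuous_actions
  have hfst : Continuous fun x : M.K => x.1.1 := continuous_fst.comp continuous_subtype_val
  -- No mass is lost in the embedding: the limit lives on the closure of the graph, and its first
  -- marginal is the image of a law on `S`. Over points of `f`'s range the closure adds nothing to
  -- the graph.
  have hstep : ∀ (θ : ℕ → ProbabilityMeasure M.K)
      (ρ : ProbabilityMeasure ((ℕ → unitInterval) × (ℕ → unitInterval)))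
      (η : ProbabilityMeasure S),
      Tendsto (fun k => (θ k).map hem.measurable.aemeasurable) atTop (𝓝 ρ) →
      Tendsto (fun k => (θ k).map hfst.measurable.aemeasurable) atTop (𝓝 η) →
      ∃ ν : ProbabilityMeasure M.K, Tendsto θ atTop (𝓝 ν) ∧ M.stateMarginal ν = η := by
    intro θ ρ η hρ hη
    have h1 := ProbabilityMeasure.tendsto_map_of_tendsto_of_continuous _ _ hρ continuous_fst
    have h2 := ProbabilityMeasure.tendsto_map_of_tendsto_of_continuous _ _ hη hf.continuous
    have h3 : ∀ k, ((θ k).map hem.measurable.aemeasurable).map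
        (continuous_fst (X := ℕ → unitInterval)
          (Y := ℕ → unitInterval)).measurable.aemeasurable =
        ((θ k).map hfst.measurable.aemeasurable).map hf.continuous.measurable.aemeasurable := by
      intro k
      apply ProbabilityMeasure.toMeasure_injective
      simp only [ProbabilityMeasure.toMeasure_map]
      rw [Measure.map_map measurable_fst hem.measurable,
        Measure.map_map hfm.measurable hfst.measurable]
      congr 1
      ext1 x
      exact hfe x
    simp_rw [h3] at h1
    have h4 := congrArg ProbabilityMeasure.toMeasure (tendsto_nhds_unique h1 h2)
    simp only [ProbabilityMeasure.toMeasure_map] at h4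
    have h5 : (ρ : Measure ((ℕ → unitInterval) × (ℕ → unitInterval))) (Prod.fst ⁻¹' (Set.range f)ᶜ) = 0 := by
      rw [← Measure.map_apply measurable_fst hfm.measurableSet_range.compl, h4,
        Measure.map_apply hfm.measurable hfm.measurableSet_range.compl]
      simp
    have h6 : (ρ : Measure ((ℕ → unitInterval) × (ℕ → unitInterval))) (closure (Set.range e))ᶜ = 0 := by
      rw [prob_compl_eq_zero_iff isClosed_closure.measurableSet]
      refine le_antisymm prob_le_one ?_
      refine le_trans ?_ (ProbabilityMeasure.limsup_measure_closed_le_of_tendsto hρ isClosed_closure)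
      have : ∀ k, ((θ k).map hem.measurable.aemeasurable : Measure _) (closure (Set.range e)) = 1 :=
        fun k => by
          rw [ProbabilityMeasure.map_apply' _ _ isClosed_closure.measurableSet,
            Set.preimage_eq_univ_iff.2 subset_closure, measure_univ]
      simp only [this]
      simp
    have h7 : (ρ : Measure ((ℕ → unitInterval) × (ℕ → unitInterval))) (Set.range e)ᶜ = 0 := by
      refine measure_mono_null ?_ (measure_union_null h5 h6)
      rintro ⟨y, z⟩ hyz
      by_contra hnot
      simp only [Set.mem_union, Set.mem_preimage, Set.mem_compl_iff, not_or, not_not] at hnot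
      obtain ⟨⟨s, rfl⟩, h⟩ := hnot
      exact hyz (hcl s z h)
    obtain ⟨ν, hν⟩ := exists_tendsto_of_tendsto_map he hem hρ h7
    refine ⟨ν, hν, ?_⟩
    have h8 := ProbabilityMeasure.tendsto_map_of_tendsto_of_continuous _ _ hν hfst
    exact congrArg ProbabilityMeasure.toMeasure (tendsto_nhds_unique h8 hη)
  -- Compactness is applied to the whole sequence of stage laws, so one subsequence serves all
  -- times.
  obtain ⟨ρ, -, σ, hσ, hρ⟩ := isCompact_univ.tendsto_subseq
    (x := fun k n => (M.stageProbability (π k) n).map hem.measurable.aemeasurable)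
    (fun k => Set.mem_univ _)
  rw [tendsto_pi_nhds] at hρ
  have hzero : ∀ k, (M.stageProbability (π (σ k)) 0).map hfst.measurable.aemeasurable =
      ⟨M.μ, M.isProbabilityMeasure_μ⟩ := fun k => by
    apply ProbabilityMeasure.toMeasure_injective
    exact M.stateMarginal_stageLaw_zero (π (σ k))
  have hsucc : ∀ n k, (M.stageProbability (π (σ k)) (n + 1)).map hfst.measurable.aemeasurable =
      (M.stageProbability (π (σ k)) n).compKernel M.p := fun n k => by
    apply ProbabilityMeasure.toMeasure_injective
    exact M.stateMarginal_stageLaw_succ (π (σ k)) n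
  have hlim : ∀ n, ∃ ν : ProbabilityMeasure M.K,
      Tendsto (fun k => M.stageProbability (π (σ k)) n) atTop (𝓝 ν) := by
    intro n
    induction n with
    | zero =>
      obtain ⟨ν, hν, -⟩ := hstep _ _ ⟨M.μ, M.isProbabilityMeasure_μ⟩ (hρ 0)
        (tendsto_const_nhds.congr fun k => (hzero k).symm)
      exact ⟨ν, hν⟩
    | succ n ih =>
      obtain ⟨ν, hν⟩ := ih
      obtain ⟨ν', hν', -⟩ := hstep _ _ (ν.compKernel M.p) (hρ (n + 1))
        ((tendsto_comp_of_weaklyContinuous hM.continuous_p hν).congr fun k => (hsucc n k).symm)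
      exact ⟨ν', hν'⟩
  choose ν hν using hlim
  have hmarg : ∀ n, Tendsto (fun k => (M.stageProbability (π (σ k)) n).map
      hfst.measurable.aemeasurable) atTop (𝓝 ((ν n).map hfst.measurable.aemeasurable)) := fun n =>
    ProbabilityMeasure.tendsto_map_of_tendsto_of_continuous _ _ (hν n) hfst
  refine ⟨σ, hσ, ν, hν, ?_, fun n => ?_⟩
  · have h : Tendsto (fun k => (M.stageProbability (π (σ k)) 0).map
        hfst.measurable.aemeasurable) atTop (𝓝 ⟨M.μ, M.isProbabilityMeasure_μ⟩) :=
      tendsto_const_nhds.congr fun k => (hzero k).symm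
    exact congrArg ProbabilityMeasure.toMeasure (tendsto_nhds_unique (hmarg 0) h)
  · have h : Tendsto (fun k => (M.stageProbability (π (σ k)) (n + 1)).map
        hfst.measurable.aemeasurable) atTop (𝓝 ((ν n).compKernel M.p)) :=
      (tendsto_comp_of_weaklyContinuous hM.continuous_p (hν n)).congr fun k =>
        (hsucc n k).symm
    exact congrArg ProbabilityMeasure.toMeasure (tendsto_nhds_unique (hmarg (n + 1)) h)

end Compactness

section LowerSemicontinuity

variable {S : Type u} {A : Type v}
  [TopologicalSpace S] [TopologicalSpace.MetrizableSpace S] [MeasurableSpace S] [BorelSpace S]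
  [TopologicalSpace A] [TopologicalSpace.MetrizableSpace A] [SecondCountableTopology A]
  [MeasurableSpace A] [BorelSpace A] {m : ℕ}

/-- If the laws of the state-action pairs converge weakly, then the integrals of a nonnegative
lower semicontinuous function with respect to the occupation measures are asymptotically at least
its integral with respect to the limit occupation measure. -/
theorem lintegral_le_liminf_lintegral_occupation (M : CMDP S A m) {π : ℕ → M.Policy}
    {ν : ℕ → ProbabilityMeasure M.K}
    (hν : ∀ n, Tendsto (fun k => M.stageProbability (π k) n) atTop (𝓝 (ν n)))
    {g : M.K → ℝ≥0∞} (hg : LowerSemicontinuous g) :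
    ∫⁻ x, g x ∂(Measure.sum fun n => M.discount n • (ν n : Measure M.K)) ≤
      liminf (fun k => ∫⁻ x, g x ∂(M.occupation (π k))) atTop := by
  have hn : ∀ n, M.discount n * ∫⁻ x, g x ∂(ν n : Measure M.K) ≤
      liminf (fun k => M.discount n * ∫⁻ x, g x ∂(M.stageLaw (π k) n)) atTop := by
    intro n
    have h1 : ∫⁻ x, g x ∂(ν n : Measure M.K) ≤
        liminf (fun k => ∫⁻ x, g x ∂(M.stageLaw (π k) n)) atTop :=
      lintegral_le_liminf_lintegral_of_lowerSemicontinuous hg fun G hG =>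
        ProbabilityMeasure.le_liminf_measure_open_of_tendsto (hν n) hG
    calc M.discount n * ∫⁻ x, g x ∂(ν n : Measure M.K)
        ≤ M.discount n * liminf (fun k => ∫⁻ x, g x ∂(M.stageLaw (π k) n)) atTop := by gcongr
      _ = liminf (fun k => M.discount n * ∫⁻ x, g x ∂(M.stageLaw (π k) n)) atTop :=
          (ENNReal.liminf_const_mul_of_ne_top ENNReal.ofReal_ne_top).symm
  simp_rw [lintegral_occupation, lintegral_sum_measure, lintegral_smul_measure, smul_eq_mul]
  calc ∑' n, M.discount n * ∫⁻ x, g x ∂(ν n : Measure M.K)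
      ≤ ∑' n, liminf (fun k => M.discount n * ∫⁻ x, g x ∂(M.stageLaw (π k) n)) atTop :=
        ENNReal.tsum_le_tsum hn
    _ ≤ liminf (fun k => ∑' n, M.discount n * ∫⁻ x, g x ∂(M.stageLaw (π k) n)) atTop := by
        simp_rw [← lintegral_count]
        exact lintegral_liminf_le fun k => measurable_of_countable _

end LowerSemicontinuity

end

end CMDP

/-! ### Extended-real arithmetic for truncated rewards -/

theorem EReal.antitone_toENNReal_sub (c : EReal) : Antitone fun y : EReal => (c - y).toENNReal :=
  fun _ _ h => EReal.toENNReal_le_toENNReal (EReal.sub_le_sub le_rfl h)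

theorem EReal.continuous_toENNReal_coe_sub (c : ℝ) :
    Continuous fun y : EReal => ((c : EReal) - y).toENNReal := by
  have h : Continuous fun y : EReal => (c : EReal) + -y := continuous_iff_continuousAt.2 fun y =>
    (EReal.continuousAt_add (p := ((c : EReal), -y)) (Or.inl (EReal.coe_ne_top c))
    (Or.inl (EReal.coe_ne_bot c))).comp (f := fun y => ((c : EReal), -y)) (by fun_prop)
  exact EReal.continuous_toENNReal.comp h

/-- Moves a bound on `J` into `ℝ≥0∞`, where only sums occur; `c` is split into its positive and
negative parts. For `y = ∞` both sides fail. -/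
theorem EReal.coe_le_coe_ennreal_sub_iff (c : ℝ) {x y : ℝ≥0∞} (hx : x ≠ ∞) :
    (c : EReal) ≤ (x : EReal) - (y : EReal) ↔
      ENNReal.ofReal c + y ≤ x + ENNReal.ofReal (-c) := by
  lift x to NNReal using hx
  induction y with
  | top =>
    have : ((x : ℝ≥0∞) : EReal) - ((⊤ : ℝ≥0∞) : EReal) = ⊥ := by
      rw [EReal.coe_ennreal_top, sub_eq_add_neg, EReal.neg_top, EReal.add_bot]
    rw [this, add_top, top_le_iff]
    simp
  | coe y =>
    have h1 : ((x : ℝ≥0∞) : EReal) - ((y : ℝ≥0∞) : EReal) = ((x - y : ℝ) : EReal) := by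
      rw [EReal.coe_sub]
      rfl
    rw [h1, EReal.coe_le_coe_iff, ENNReal.ofReal, ENNReal.ofReal, ← ENNReal.coe_add,
      ← ENNReal.coe_add, ENNReal.coe_le_coe, ← NNReal.coe_le_coe, NNReal.coe_add, NNReal.coe_add,
      Real.coe_toNNReal', Real.coe_toNNReal']
    rcases le_total 0 c with hc | hc
    · rw [max_eq_left hc, max_eq_right (by linarith)]
      constructor <;> intro h <;> linarith
    · rw [max_eq_right hc, max_eq_left (by linarith)]
      constructor <;> intro h <;> linarith

/-- This is `l - r ≤ (l - r)⁺` rearranged so that no subtraction of infinities appears. -/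
theorem EReal.add_toENNReal_neg_le (l : ℝ) (hl : 0 ≤ l) {r : EReal} (hr : r ≠ ⊤) :
    ENNReal.ofReal l + (-r).toENNReal ≤ r.toENNReal + ((l : EReal) - r).toENNReal := by
  induction r with
  | top => exact absurd rfl hr
  | bot => simp
  | coe r =>
    rw [← EReal.coe_neg, ← EReal.coe_sub]
    simp only [EReal.real_coe_toENNReal]
    rcases le_total 0 r with h | h
    · rw [ENNReal.ofReal_of_nonpos (by linarith : -r ≤ 0), add_zero]
      refine le_trans ?_ ENNReal.ofReal_add_le
      exact ENNReal.ofReal_le_ofReal (by linarith)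
    · rw [ENNReal.ofReal_of_nonpos h, zero_add, ← ENNReal.ofReal_add hl (by linarith)]
      exact ENNReal.ofReal_le_ofReal (by linarith)

/-- The excess of `(l - r)⁺` over `l - r` is `(r - l)⁺`, which vanishes unless `l ≤ w` and is then
at most `w`. -/
theorem EReal.toENNReal_add_toENNReal_sub_le (l : ℝ) (hl : 0 ≤ l) {r : EReal} {w : ℝ}
    (hr : r ≤ (w : EReal)) :
    r.toENNReal + ((l : EReal) - r).toENNReal ≤
      ENNReal.ofReal l + (-r).toENNReal + if l ≤ w then ENNReal.ofReal w else 0 := by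
  induction r with
  | top => exact absurd hr (by simp)
  | bot => simp
  | coe r =>
    rw [EReal.coe_le_coe_iff] at hr
    rw [← EReal.coe_neg, ← EReal.coe_sub]
    simp only [EReal.real_coe_toENNReal]
    rcases le_total l r with h | h
    · rw [ENNReal.ofReal_of_nonpos (by linarith : l - r ≤ 0), if_pos (h.trans hr), add_zero]
      exact (ENNReal.ofReal_le_ofReal hr).trans le_add_self
    · refine le_trans ?_ le_self_add
      rcases le_total 0 r with h0 | h0
      · rw [← ENNReal.ofReal_add h0 (by linarith)]
        refine le_trans ?_ le_self_add
        exact ENNReal.ofReal_le_ofReal (by linarith)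
      · rw [ENNReal.ofReal_of_nonpos h0, zero_add, ← ENNReal.ofReal_add hl (by linarith)]
        exact ENNReal.ofReal_le_ofReal (by linarith)

/-! ### Uniform integrability and upper semicontinuity of the rewards -/

namespace CMDP

noncomputable section

section UniformIntegrability

variable {S : Type u} {A : Type v} [MeasurableSpace S] [MeasurableSpace A] {m : ℕ}
  {M : CMDP S A m} {w : S → ℝ}

/-- The weight function, restricted to the states where it is at least `l`. -/
def weightTail (w : S → ℝ) (l : ℕ) : S → ℝ≥0∞ :=
  {s : S | (l : ℝ) ≤ w s}.indicator fun s => ENNReal.ofReal (w s)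

theorem measurable_weightTail (hw : Measurable w) (l : ℕ) : Measurable (weightTail w l) :=
  hw.ennreal_ofReal.indicator (measurableSet_le measurable_const hw)

theorem lintegral_stageLaw_state (π : M.Policy) (n : ℕ) {g : S → ℝ≥0∞} (hg : Measurable g) :
    ∫⁻ x, g x.1.1 ∂(M.stageLaw π n) = ∫⁻ ω, g (M.state n ω) ∂(M.strategicMeasure π) := by
  exact lintegral_map (hg.comp M.measurable_fst_coe) (measurable_pi_apply n)

/-- The weight function is uniformly integrable with respect to the occupation measures. -/
theorem UniformlySmallTails.tendsto_iSup_occupation (hA2 : M.UniformlySmallTails w)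
    (hw : Measurable w) :
    Tendsto (fun l : ℕ => ⨆ π : M.Policy, ∫⁻ x, weightTail w l x.1.1 ∂(M.occupation π))
      atTop (𝓝 0) := by
  rw [ENNReal.tendsto_nhds_zero]
  intro ε hε
  have hε2 : 0 < ε / 2 := ENNReal.half_pos hε.ne'
  obtain ⟨N, hN⟩ := (ENNReal.tendsto_nhds_zero.1 hA2.tail (ε / 2) hε2).exists
  have hfin : Tendsto (fun l : ℕ => ∑ n ∈ Finset.range N, M.discount n *
      ⨆ π : M.Policy, ∫⁻ ω, weightTail w l (M.state n ω) ∂(M.strategicMeasure π)) atTop (𝓝 0) := by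
    have : Tendsto (fun l : ℕ => ∑ n ∈ Finset.range N, M.discount n *
        ⨆ π : M.Policy, ∫⁻ ω, weightTail w l (M.state n ω) ∂(M.strategicMeasure π)) atTop
        (𝓝 (∑ n ∈ Finset.range N, M.discount n * 0)) :=
      tendsto_finsetSum _ fun n _ =>
        ENNReal.Tendsto.const_mul (hA2.unifIntegrable n) (Or.inr ENNReal.ofReal_ne_top)
    simpa using this
  filter_upwards [ENNReal.tendsto_nhds_zero.1 hfin (ε / 2) hε2] with l hl
  refine iSup_le fun π => ?_
  rw [M.lintegral_occupation π fun x => weightTail w l x.1.1]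
  -- Times from `N` on are controlled by the uniform tail bound for any `l`; the finitely many
  -- earlier ones by uniform integrability at each time.
  rw [← ENNReal.summable.sum_add_tsum_nat_add' (k := N), ← ENNReal.add_halves ε]
  refine add_le_add (le_trans ?_ hl) (le_trans ?_ ((le_iSup _ π).trans hN))
  · refine Finset.sum_le_sum fun n _ => ?_
    gcongr
    rw [lintegral_stageLaw_state π n (measurable_weightTail hw l)]
    exact le_iSup (fun π : M.Policy =>
      ∫⁻ ω, weightTail w l (M.state n ω) ∂(M.strategicMeasure π)) π
  · have hmeas : ∀ n, Measurable fun ω : ℕ → M.K => ENNReal.ofReal (w (M.state n ω)) := fun n =>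
      (hw.comp (M.measurable_fst_coe.comp (measurable_pi_apply n))).ennreal_ofReal
    rw [lintegral_tsum fun k => ((hmeas _).const_mul _).aemeasurable]
    refine ENNReal.tsum_le_tsum fun k => ?_
    rw [lintegral_const_mul _ (hmeas _), add_comm k N,
      lintegral_stageLaw_state π _ (measurable_weightTail hw l)]
    gcongr
    exact Set.indicator_le_self _ _ _

theorem occupation_univ (π : M.Policy) : M.occupation π Set.univ = ∑' n, M.discount n := by
  simp [occupation, Measure.sum_apply _ MeasurableSet.univ]

/-- Together with `le_lintegral_occupation_sub`, this trades the reward for the nonnegative function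
`(l - r)⁺`, with an error uniform in the policy that tends to zero with `l`. -/
theorem lintegral_occupation_sub_le (hA1 : M.BoundedAboveBy w) (i : Fin (m + 1)) (l : ℕ)
    (π : M.Policy) :
    M.Jpos i π + ∫⁻ x, (((l : ℝ) : EReal) - M.r i x).toENNReal ∂(M.occupation π) ≤
      (l : ℝ≥0∞) * ∑' n, M.discount n + M.Jneg i π +
        ⨆ π : M.Policy, ∫⁻ x, weightTail w l x.1.1 ∂(M.occupation π) := by
  have hr := M.measurable_r i
  have hw : Measurable fun x : M.K => weightTail w l x.1.1 :=
    (measurable_weightTail hA1.measurable l).comp M.measurable_fst_coe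
  have hsup := le_iSup (fun π : M.Policy => ∫⁻ x, weightTail w l x.1.1 ∂(M.occupation π)) π
  refine le_trans ?_ (add_le_add_right hsup _)
  rw [Jpos_eq, Jneg_eq, ← lintegral_add_left hr.ereal_toENNReal, ← occupation_univ π,
    ← lintegral_const, ← lintegral_add_left measurable_const,
    ← lintegral_add_right _ hw]
  refine lintegral_mono fun x => ?_
  have := EReal.toENNReal_add_toENNReal_sub_le (l : ℝ) (Nat.cast_nonneg l) (hA1.r_le i x)
  rw [ENNReal.ofReal_natCast] at this
  refine this.trans_eq ?_
  rw [weightTail, Set.indicator_apply]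
  rfl

theorem le_lintegral_occupation_sub (i : Fin (m + 1)) (l : ℕ) (π : M.Policy) :
    (l : ℝ≥0∞) * ∑' n, M.discount n + M.Jneg i π ≤
      M.Jpos i π + ∫⁻ x, (((l : ℝ) : EReal) - M.r i x).toENNReal ∂(M.occupation π) := by
  rw [Jpos_eq, Jneg_eq, ← lintegral_add_left (M.measurable_r i).ereal_toENNReal,
    ← occupation_univ π, ← lintegral_const, ← lintegral_add_left measurable_const]
  refine lintegral_mono fun x => ?_
  have := EReal.add_toENNReal_neg_le (l : ℝ) (Nat.cast_nonneg l) (M.r_ne_top i x)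
  rwa [ENNReal.ofReal_natCast] at this

theorem Jpos_ne_top (hA1 : M.BoundedAboveBy w) (hA2 : M.UniformlySmallTails w) (i : Fin (m + 1))
    (π : M.Policy) : M.Jpos i π ≠ ∞ := by
  obtain ⟨l, hl⟩ := ((hA2.tendsto_iSup_occupation hA1.measurable).eventually_lt_const
    (zero_lt_one)).exists
  have hle : M.Jpos i π ≤ (l : ℝ≥0∞) * ∑' n, M.discount n +
      ⨆ π : M.Policy, ∫⁻ x, weightTail w l x.1.1 ∂(M.occupation π) := by
    refine le_trans ?_ (add_le_add_right (le_iSup (fun π : M.Policy =>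
      ∫⁻ x, weightTail w l x.1.1 ∂(M.occupation π)) π) _)
    rw [Jpos_eq, ← occupation_univ π, ← lintegral_const, ← lintegral_add_left measurable_const]
    refine lintegral_mono fun x => ?_
    refine (EReal.toENNReal_le_toENNReal (hA1.r_le i x)).trans ?_
    rw [EReal.real_coe_toENNReal, weightTail, Set.indicator_apply]
    split_ifs with h
    · exact le_add_self
    · rw [add_zero, ← ENNReal.ofReal_natCast]
      exact ENNReal.ofReal_le_ofReal (not_le.1 h).le
  exact (hle.trans_lt (ENNReal.add_lt_top.2 ⟨ENNReal.mul_lt_top (ENNReal.natCast_lt_top l)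
    M.tsum_discount_ne_top.lt_top, hl.trans ENNReal.one_lt_top⟩)).ne

end UniformIntegrability

section Optimality

variable {S : Type u} {A : Type v}
  [TopologicalSpace S] [TopologicalSpace.MetrizableSpace S] [MeasurableSpace S] [BorelSpace S]
  [TopologicalSpace A] [TopologicalSpace.MetrizableSpace A] [SecondCountableTopology A]
  [MeasurableSpace A] [BorelSpace A] {m : ℕ} {M : CMDP S A m} {w : S → ℝ}

/-- The expected discounted rewards are upper semicontinuous along weakly convergent laws. -/
theorem le_J_of_tendsto_stageProbability (hA1 : M.BoundedAboveBy w)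
    (hA2 : M.UniformlySmallTails w) {i : Fin (m + 1)} (hr : UpperSemicontinuous (M.r i))
    {π : ℕ → M.Policy} {ν : ℕ → ProbabilityMeasure M.K}
    (hν : ∀ n, Tendsto (fun k => M.stageProbability (π k) n) atTop (𝓝 (ν n))) {π' : M.Policy}
    (hπ' : M.occupation π' = Measure.sum fun n => M.discount n • (ν n : Measure M.K)) {c : ℝ}
    (hc : ∀ᶠ k in atTop, (c : EReal) ≤ M.J i (π k)) : (c : EReal) ≤ M.J i π' := by
  have hfin := fun π => Jpos_ne_top hA1 hA2 i π
  unfold J at hc ⊢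
  simp_rw [EReal.coe_le_coe_ennreal_sub_iff c (hfin _)] at hc ⊢
  set E : ℕ → ℝ≥0∞ := fun l =>
    ⨆ π : M.Policy, ∫⁻ x, weightTail w l x.1.1 ∂(M.occupation π) with hE
  have hElim : Tendsto E atTop (𝓝 0) := hA2.tendsto_iSup_occupation hA1.measurable
  -- For fixed `l`, `(l - r)⁺` is nonnegative and lower semicontinuous, so its integral cannot jump
  -- up in the limit. Only the error `E l` remains, and `l → ∞` removes it.
  have key : ∀ l : ℕ, ENNReal.ofReal c + M.Jneg i π' ≤
      M.Jpos i π' + ENNReal.ofReal (-c) + E l := by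
    intro l
    set G : M.Policy → ℝ≥0∞ := fun π =>
      ∫⁻ x, (((l : ℝ) : EReal) - M.r i x).toENNReal ∂(M.occupation π) with hG
    set T : ℝ≥0∞ := (l : ℝ≥0∞) * ∑' n, M.discount n with hT
    have hTtop : T ≠ ∞ := ENNReal.mul_ne_top (ENNReal.natCast_ne_top l) M.tsum_discount_ne_top
    have hGk : ∀ᶠ k in atTop, G (π k) + ENNReal.ofReal c ≤ T + E l + ENNReal.ofReal (-c) := by
      filter_upwards [hc] with k hk
      -- The real lower bound `c` forces finiteness, which the cancellation below requires.
      have hneg : M.Jneg i (π k) ≠ ∞ := by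
        have h1 := (le_add_self.trans hk).trans_lt
          (ENNReal.add_lt_top.2 ⟨(hfin (π k)).lt_top, ENNReal.ofReal_lt_top⟩)
        exact h1.ne
      rw [← ENNReal.add_le_add_iff_right hneg]
      calc G (π k) + ENNReal.ofReal c + M.Jneg i (π k)
          = G (π k) + (ENNReal.ofReal c + M.Jneg i (π k)) := add_assoc _ _ _
        _ ≤ G (π k) + (M.Jpos i (π k) + ENNReal.ofReal (-c)) := by gcongr
        _ = (M.Jpos i (π k) + G (π k)) + ENNReal.ofReal (-c) := by ring
        _ ≤ (T + M.Jneg i (π k) + E l) + ENNReal.ofReal (-c) :=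
            add_le_add (lintegral_occupation_sub_le hA1 i l (π k)) le_rfl
        _ = T + E l + ENNReal.ofReal (-c) + M.Jneg i (π k) := by ring
    have hlsc : LowerSemicontinuous fun x => (((l : ℝ) : EReal) - M.r i x).toENNReal :=
      (EReal.continuous_toENNReal_coe_sub (l : ℝ)).comp_upperSemicontinuous_antitone hr
        (EReal.antitone_toENNReal_sub _)
    have hGlim : G π' ≤ liminf (fun k => G (π k)) atTop := by
      have := M.lintegral_le_liminf_lintegral_occupation hν hlsc
      rwa [← hπ'] at this
    have hGπ' : G π' + ENNReal.ofReal c ≤ T + E l + ENNReal.ofReal (-c) := by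
      obtain ⟨k, hk⟩ := hGk.exists
      have h1 : G π' ≤ T + E l + ENNReal.ofReal (-c) - ENNReal.ofReal c := by
        refine hGlim.trans ?_
        refine (liminf_le_liminf (hGk.mono fun k hk =>
          ENNReal.le_sub_of_add_le_right ENNReal.ofReal_ne_top hk)).trans_eq ?_
        simp
      calc G π' + ENNReal.ofReal c
          ≤ T + E l + ENNReal.ofReal (-c) - ENNReal.ofReal c + ENNReal.ofReal c := by gcongr
        _ = T + E l + ENNReal.ofReal (-c) := tsub_add_cancel_of_le (le_add_self.trans hk)
    rw [← ENNReal.add_le_add_iff_right hTtop]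
    calc ENNReal.ofReal c + M.Jneg i π' + T
        = T + M.Jneg i π' + ENNReal.ofReal c := by ring
      _ ≤ M.Jpos i π' + G π' + ENNReal.ofReal c :=
          add_le_add (le_lintegral_occupation_sub i l π') le_rfl
      _ = M.Jpos i π' + (G π' + ENNReal.ofReal c) := add_assoc _ _ _
      _ ≤ M.Jpos i π' + (T + E l + ENNReal.ofReal (-c)) := by gcongr
      _ = M.Jpos i π' + ENNReal.ofReal (-c) + E l + T := by ring
  have hlim := hElim.const_add (M.Jpos i π' + ENNReal.ofReal (-c))
  rw [add_zero] at hlim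
  exact ge_of_tendsto' hlim key

theorem exists_isOptimal_of_weaklyContinuous [SecondCountableTopology S] [StandardBorelSpace S]
    [StandardBorelSpace A] (hA1 : M.BoundedAboveBy w) (hA2 : M.UniformlySmallTails w)
    (hM : M.WeaklyContinuous) {d : Fin m → ℝ} (hd : M.Nontrivial d) :
    ∃ φ : M.StationaryPolicy, M.IsOptimal d φ.toPolicy := by
  obtain ⟨π₀, hπ₀, -⟩ := hd
  have : Nonempty A := by
    have := M.isProbabilityMeasure_μ
    obtain ⟨s⟩ := M.μ.nonempty_of_neZero
    exact ⟨(M.exists_action s).choose⟩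
  obtain ⟨u, -, hu, hmem⟩ := exists_seq_tendsto_sSup (S := M.J 0 '' {π | M.Feasible d π})
    ⟨_, π₀, hπ₀, rfl⟩ (OrderTop.bddAbove _)
  choose π hπ hπu using hmem
  obtain ⟨σ, hσ, ν, hν, h0, hsucc⟩ := M.exists_subseq_tendsto_stageProbability hM π
  obtain ⟨φ, hφ⟩ := exists_stationaryPolicy_occupation_eq π₀ (fun n => (ν n : Measure M.K)) h0 hsucc
  refine ⟨φ, fun i => ?_, fun π' hπ' => ?_⟩
  · exact le_J_of_tendsto_stageProbability hA1 hA2 (hM.upperSemicontinuous_r _) hν hφ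
      (Eventually.of_forall fun k => hπ (σ k) i)
  · refine (le_sSup (show M.J 0 π' ∈ M.J 0 '' {π | M.Feasible d π} from ⟨π', hπ', rfl⟩)).trans (le_of_forall_lt fun c hc => ?_)
    -- The semicontinuity lemma takes real bounds, hence a real number strictly below the supremum.
    obtain ⟨q, hcq, hq⟩ := EReal.lt_iff_exists_real_btwn.1 hc
    refine hcq.trans_le (le_J_of_tendsto_stageProbability hA1 hA2 (hM.upperSemicontinuous_r _)
      hν hφ ?_)
    filter_upwards [(hu.comp hσ.tendsto_atTop).eventually_const_lt hq] with k hk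
    rw [hπu]
    exact hk.le

end Optimality

end

end CMDP

/-! ### Borel spaces as standard Borel spaces -/

theorem MeasurableEmbedding.standardBorelSpace {X Y : Type*} [MeasurableSpace X]
    [MeasurableSpace Y] [StandardBorelSpace Y] {f : X → Y} (hf : MeasurableEmbedding f) :
    StandardBorelSpace X := by
  have : StandardBorelSpace (Set.range f) := hf.measurableSet_range.standardBorel
  let := upgradeStandardBorel (Set.range f)
  let τ : TopologicalSpace X := TopologicalSpace.induced hf.equivRange inferInstance
  have : PolishSpace X := hf.equivRange.toEquiv.polishSpace_induced
  have : BorelSpace X := ⟨by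
    refine Eq.trans ?_ (borel_comap (f := hf.equivRange)).symm
    rw [← BorelSpace.measurable_eq (α := Set.range f)]
    exact hf.equivRange.measurableEmbedding.comap_eq.symm⟩
  infer_instance

theorem IsBorelSpace.metrizableSpace {Y : Type u} [TopologicalSpace Y] (h : IsBorelSpace Y) :
    TopologicalSpace.MetrizableSpace Y := by
  obtain ⟨X, _, _, f, hf, -⟩ := h.exists_embedding
  exact hf.metrizableSpace

theorem IsBorelSpace.secondCountableTopology {Y : Type u} [TopologicalSpace Y]
    (h : IsBorelSpace Y) : SecondCountableTopology Y := by
  obtain ⟨X, _, _, f, hf, -⟩ := h.exists_embedding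
  exact hf.secondCountableTopology

theorem IsBorelSpace.standardBorelSpace {Y : Type u} [TopologicalSpace Y] [MeasurableSpace Y]
    [BorelSpace Y] (h : IsBorelSpace Y) : StandardBorelSpace Y := by
  obtain ⟨X, _, _, f, hf, hr⟩ := h.exists_embedding
  let : MeasurableSpace X := borel X
  have : BorelSpace X := ⟨rfl⟩
  exact (hf.measurableEmbedding hr).standardBorelSpace

/-! ### Change of topology on the state space -/

/-- A countable set is contained in a countable set closed under countably many binary
operations. -/
theorem exists_countable_closed_under {α ι : Type*} [Countable ι] {T₀ : Set α} (h₀ : T₀.Countable)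
    (op : ι → α → α → α) :
    ∃ T : Set α, T₀ ⊆ T ∧ T.Countable ∧ ∀ i, ∀ a ∈ T, ∀ b ∈ T, op i a b ∈ T := by
  let F : Set α → Set α := fun T => T ∪ ⋃ i, Set.image2 (op i) T T
  have hmono : Monotone fun n => F^[n] T₀ :=
    monotone_nat_of_le_succ fun n => by
      rw [Function.iterate_succ_apply']
      exact Set.subset_union_left
  refine ⟨⋃ n, F^[n] T₀, Set.subset_iUnion_of_subset 0 (Set.Subset.refl _), ?_, ?_⟩
  · refine Set.countable_iUnion fun n => ?_
    induction n with
    | zero => exact h₀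
    | succ n ih =>
      rw [Function.iterate_succ_apply']
      exact ih.union (Set.countable_iUnion fun i => ih.image2 ih _)
  · intro i a ha b hb
    obtain ⟨j, hj⟩ := Set.mem_iUnion.1 ha
    obtain ⟨k, hk⟩ := Set.mem_iUnion.1 hb
    refine Set.mem_iUnion.2 ⟨max j k + 1, ?_⟩
    rw [Function.iterate_succ_apply']
    exact Or.inr (Set.mem_iUnion.2 ⟨i, Set.mem_image2_of_mem (hmono (le_max_left j k) hj)
      (hmono (le_max_right j k) hk)⟩)

/-- A Borel subset of a Borel graph with compact sections, which is relatively open in each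
section, is the trace on the graph of a countable union of rectangles with measurable base and
open sides. -/
theorem exists_mem_iff_of_isOpen_sections {S A : Type*} [MeasurableSpace S] [StandardBorelSpace S]
    [TopologicalSpace A] [TopologicalSpace.MetrizableSpace A] [SecondCountableTopology A]
    [MeasurableSpace A] [BorelSpace A] [StandardBorelSpace A]
    {K : Set (S × A)} (hK : MeasurableSet K) (hcomp : ∀ s, IsCompact {a | (s, a) ∈ K})
    {E : Set K} (hE : MeasurableSet E)
    (hopen : ∀ s, IsOpen {a : {a | (s, a) ∈ K} | (⟨(s, a), a.2⟩ : K) ∈ E}) :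
    ∃ (B : ℕ → Set S) (U : ℕ → Set A), (∀ n, MeasurableSet (B n)) ∧ (∀ n, IsOpen (U n)) ∧
      ∀ x : K, x ∈ E ↔ ∃ n, x.1.1 ∈ B n ∧ x.1.2 ∈ U n := by
  let := TopologicalSpace.metrizableSpaceMetric A
  obtain ⟨g, hg⟩ := Metric.PiNatEmbed.exists_embedding_to_hilbert_cube (X := A)
  have hgm := hg.continuous.measurable.measurableEmbedding hg.injective
  have hem : MeasurableEmbedding (Prod.map id g ∘ (Subtype.val : K → S × A)) :=
    (MeasurableEmbedding.id.prodMap hgm).comp (MeasurableEmbedding.subtype_coe hK)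
  -- The part of a compact section outside `E` is compact, so its image in the Hilbert cube is
  -- closed. The cube supplies the Polish second factor that `A` itself need not be.
  obtain ⟨B, U, hB, hU, hBU⟩ := exists_compl_eq_iUnion_prod_of_isClosed_sections
    (hem.measurableSet_image.2 hE.compl) (fun s => by
      have : Prod.mk s ⁻¹' ((Prod.map id g ∘ Subtype.val) '' Eᶜ) =
          (fun a : {a | (s, a) ∈ K} => g a) ''
            {a : {a | (s, a) ∈ K} | (⟨(s, a), a.2⟩ : K) ∈ E}ᶜ := by
        ext z
        constructor
        · rintro ⟨⟨⟨s', a⟩, hK'⟩, hx, hxz⟩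
          obtain ⟨rfl, rfl⟩ := Prod.mk.inj hxz
          exact ⟨⟨a, hK'⟩, hx, rfl⟩
        · rintro ⟨⟨a, ha⟩, hx, rfl⟩
          exact ⟨⟨(s, a), ha⟩, hx, rfl⟩
      rw [this]
      have : CompactSpace {a | (s, a) ∈ K} := isCompact_iff_compactSpace.1 (hcomp s)
      exact ((hopen s).isClosed_compl.isCompact.image
        (hg.continuous.comp continuous_subtype_val)).isClosed)
  refine ⟨B, fun n => g ⁻¹' U n, hB, fun n => (hU n).preimage hg.continuous, fun x => ?_⟩
  have h1 : x ∈ E ↔ (Prod.map id g ∘ Subtype.val) x ∈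
      ((Prod.map id g ∘ (Subtype.val : K → S × A)) '' Eᶜ)ᶜ := by
    rw [Set.mem_compl_iff, hem.injective.mem_set_image, Set.mem_compl_iff, not_not]
  rw [h1, hBU]
  simp

/-- A Borel graph with compact sections is upper semicontinuous for every topology on the base
that makes countably many suitable measurable sets open. -/
theorem exists_isClosed_of_isOpen {S A : Type*} [MeasurableSpace S] [StandardBorelSpace S]
    [TopologicalSpace A] [TopologicalSpace.MetrizableSpace A] [SecondCountableTopology A]
    [MeasurableSpace A] [BorelSpace A] [StandardBorelSpace A]
    {K : Set (S × A)} (hK : MeasurableSet K) (hcomp : ∀ s, IsCompact {a | (s, a) ∈ K}) :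
    ∃ B : ℕ → Set S, (∀ n, MeasurableSet (B n)) ∧ ∀ _ : TopologicalSpace S, (∀ n, IsOpen (B n)) →
      ∀ F : Set A, IsClosed F → IsClosed {s : S | ({a | (s, a) ∈ K} ∩ F).Nonempty} := by
  let := TopologicalSpace.metrizableSpaceMetric A
  obtain ⟨g, hg⟩ := Metric.PiNatEmbed.exists_embedding_to_hilbert_cube (X := A)
  have hgm := hg.continuous.measurable.measurableEmbedding hg.injective
  obtain ⟨B, U, hB, hU, hBU⟩ := exists_compl_eq_iUnion_prod_of_isClosed_sections
    ((MeasurableEmbedding.id.prodMap hgm).measurableSet_image.2 hK) (fun s => by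
      have : Prod.mk s ⁻¹' (Prod.map id g '' K) = g '' {a | (s, a) ∈ K} := by
        ext z
        simp
      rw [this]
      exact ((hcomp s).image hg.continuous).isClosed)
  refine ⟨B, hB, fun τ hBo F hF => ?_⟩
  obtain ⟨F', hF', rfl⟩ := hg.isClosed_iff.1 hF
  -- With the bases open, the graph is closed in `S` times the cube, and projecting along the
  -- compact cube preserves closedness.
  have hgraph : IsClosed (Prod.map id g '' K) := by
    rw [← isOpen_compl_iff, hBU]
    exact isOpen_iUnion fun n => (hBo n).prod (hU n)
  have : {s : S | ({a | (s, a) ∈ K} ∩ g ⁻¹' F').Nonempty} =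
      Prod.fst '' (Prod.map id g '' K ∩ Prod.snd ⁻¹' F') := by
    ext s
    constructor
    · rintro ⟨a, ha, haF⟩
      exact ⟨(s, g a), ⟨⟨(s, a), ha, rfl⟩, haF⟩, rfl⟩
    · rintro ⟨_, ⟨⟨⟨s', a⟩, ha, rfl⟩, haF⟩, rfl⟩
      exact ⟨a, ha, haF⟩
  rw [this]
  exact isClosedMap_fst_of_compactSpace _ (hgraph.inter (hF'.preimage continuous_snd))

/-- A countable algebra of measurable sets that separates points is a basis of a metrizable
topology with the given Borel sets. -/
theorem exists_topology_of_countable_algebra {S : Type*} [MeasurableSpace S] [StandardBorelSpace S]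
    {D : ℕ → Set S} (hD : ∀ n, MeasurableSet (D n))
    (hsep : ∀ s t, (∀ n, s ∈ D n ↔ t ∈ D n) → s = t) (huniv : Set.univ ∈ Set.range D)
    (hcompl : ∀ n, (D n)ᶜ ∈ Set.range D) (hinter : ∀ n k, D n ∩ D k ∈ Set.range D) :
    ∃ _ : TopologicalSpace S, TopologicalSpace.MetrizableSpace S ∧ SecondCountableTopology S ∧
      BorelSpace S ∧ (∀ n, IsOpen (D n)) ∧
      ∀ G, IsOpen G → ∀ s ∈ G, ∃ n, s ∈ D n ∧ D n ⊆ G := by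
  classical
  set f : S → ℕ → Bool := fun s n => decide (s ∈ D n) with hf
  have hfi : Function.Injective f := fun s t h => hsep s t fun n => by
    simpa [hf] using congrFun h n
  have hfm : Measurable f := measurable_pi_lambda _ fun n =>
    measurable_to_bool (by
      have : (fun s => decide (s ∈ D n)) ⁻¹' {true} = D n := by ext; simp
      rw [this]
      exact hD n)
  let τ : TopologicalSpace S := TopologicalSpace.induced f inferInstance
  have hemb : IsEmbedding f := ⟨⟨rfl⟩, hfi⟩
  refine ⟨τ, hemb.metrizableSpace, hemb.secondCountableTopology, ⟨?_⟩, fun n => ?_,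
    fun G hG s hs => ?_⟩
  · refine Eq.trans ?_ (borel_comap (f := f)).symm
    rw [← BorelSpace.measurable_eq (α := ℕ → Bool)]
    -- Lusin-Souslin: an injective measurable map from a standard Borel space into Cantor space is a
    -- measurable embedding, so the induced topology has the given Borel sets.
    exact (hfm.measurableEmbedding hfi).comap_eq.symm
  · have : D n = f ⁻¹' ((fun y : ℕ → Bool => y n) ⁻¹' {true}) := by ext; simp [hf]
    rw [this]
    exact ((isOpen_discrete _).preimage (continuous_apply n)).preimage hemb.continuous
  · obtain ⟨G', hG', rfl⟩ := hemb.isOpen_iff.1 hG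
    obtain ⟨_, ⟨y, k, rfl⟩, hsk, hk⟩ :=
      (PiNat.isTopologicalBasis_cylinders fun _ : ℕ => Bool).exists_subset_of_mem_open hs hG'
    -- A cylinder prescribes finitely many memberships, so its preimage is a finite intersection of
    -- sets `D k` and complements, again in the algebra.
    have hcyl : ∀ k, ∃ n, f ⁻¹' PiNat.cylinder y k = D n := by
      intro k
      induction k with
      | zero =>
        obtain ⟨n, hn⟩ := huniv
        exact ⟨n, by simp [hn]⟩
      | succ k ih =>
        obtain ⟨n, hn⟩ := ih
        have hsucc : f ⁻¹' PiNat.cylinder y (k + 1) =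
            f ⁻¹' PiNat.cylinder y k ∩ if y k = true then D k else (D k)ᶜ := by
          ext t
          simp only [Set.mem_preimage, PiNat.mem_cylinder_iff, Set.mem_inter_iff,
            Nat.forall_lt_succ_right]
          refine and_congr_right fun _ => ?_
          cases h : y k <;> simp [hf]
        rw [hsucc, hn]
        split_ifs with h
        · obtain ⟨j, hj⟩ := hinter n k
          exact ⟨j, hj.symm⟩
        · obtain ⟨i, hi⟩ := hcompl k
          obtain ⟨j, hj⟩ := hinter n i
          exact ⟨j, by rw [hj, hi]⟩
    obtain ⟨n, hn⟩ := hcyl k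
    exact ⟨n, hn ▸ hsk, hn ▸ Set.preimage_mono hk⟩

/-- A Markov kernel is weakly continuous if the mass of every open set is lower semicontinuous. -/
theorem continuous_integral_of_lowerSemicontinuous {X Y : Type*} [TopologicalSpace X]
    [FirstCountableTopology X] [MeasurableSpace X] [TopologicalSpace Y] [MeasurableSpace Y]
    [OpensMeasurableSpace Y] {κ : Kernel X Y} [IsMarkovKernel κ]
    (h : ∀ G, IsOpen G → LowerSemicontinuous fun x => κ x G) {v : Y → ℝ} (hv : Continuous v)
    (hb : ∃ C, ∀ y, |v y| ≤ C) : Continuous fun x => ∫ y, v y ∂(κ x) := by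
  obtain ⟨C, hC⟩ := hb
  let κ' : X → ProbabilityMeasure Y := fun x => ⟨κ x, inferInstance⟩
  refine continuous_iff_continuousAt.2 fun x => ?_
  have : Tendsto κ' (𝓝 x) (𝓝 (κ' x)) :=
    tendsto_of_forall_isOpen_le_liminf' fun G hG =>
      lowerSemicontinuousAt_iff_le_liminf.1 (h G hG x)
  exact ProbabilityMeasure.tendsto_iff_forall_integral_tendsto.1 this
    (BoundedContinuousFunction.ofNormedAddCommGroup v hv C hC)

namespace CMDP

theorem isOpen_of_mem_iff {S : Type u} {A : Type v} [TopologicalSpace S] [TopologicalSpace A]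
    {K : Set (S × A)} {E : Set K} {B : ℕ → Set S} {U : ℕ → Set A} (hB : ∀ n, IsOpen (B n))
    (hU : ∀ n, IsOpen (U n)) (hE : ∀ x : K, x ∈ E ↔ ∃ n, x.1.1 ∈ B n ∧ x.1.2 ∈ U n) :
    IsOpen E := by
  have : E = Subtype.val ⁻¹' ⋃ n, B n ×ˢ U n := by
    ext x
    simp [hE x]
  rw [this]
  exact (isOpen_iUnion fun n => (hB n).prod (hU n)).preimage continuous_subtype_val

/-- A setwise continuous model is weakly continuous for some metrizable topology on the state space
with the same Borel sets. -/
theorem SetwiseContinuous.exists_topology_weaklyContinuous {S : Type u} {A : Type v}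
    [MeasurableSpace S] [StandardBorelSpace S] [TopologicalSpace A]
    [TopologicalSpace.MetrizableSpace A] [SecondCountableTopology A] [MeasurableSpace A]
    [BorelSpace A] [StandardBorelSpace A] {m : ℕ} {M : CMDP S A m} (hM : M.SetwiseContinuous) :
    ∃ _ : TopologicalSpace S, TopologicalSpace.MetrizableSpace S ∧ SecondCountableTopology S ∧
      BorelSpace S ∧ M.WeaklyContinuous := by
  have := M.isMarkovKernel_p
  obtain ⟨BK, hBK, hclosed⟩ := exists_isClosed_of_isOpen M.measurableSet_K hM.isCompact_actions
  have hr : ∀ (i : Fin (m + 1)) (q : ℚ), ∃ (B : ℕ → Set S) (U : ℕ → Set A),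
      (∀ n, MeasurableSet (B n)) ∧ (∀ n, IsOpen (U n)) ∧
      ∀ x : M.K, x ∈ {x | M.r i x < ((q : ℝ) : EReal)} ↔ ∃ n, x.1.1 ∈ B n ∧ x.1.2 ∈ U n :=
    fun i q => exists_mem_iff_of_isOpen_sections M.measurableSet_K hM.isCompact_actions
      (measurableSet_lt (M.measurable_r i) measurable_const)
      fun s => upperSemicontinuous_iff_isOpen_preimage.1 (hM.upperSemicontinuous_r i s) _
  -- Rectangles are chosen for every measurable `D`, since the countable family to which they are
  -- applied is built from their bases.
  have hp : ∀ (D : {D : Set S // MeasurableSet D}) (q : ℚ), ∃ (B : ℕ → Set S) (U : ℕ → Set A),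
      (∀ n, MeasurableSet (B n)) ∧ (∀ n, IsOpen (U n)) ∧
      ∀ x : M.K, x ∈ {x | ENNReal.ofReal q < M.p x D} ↔ ∃ n, x.1.1 ∈ B n ∧ x.1.2 ∈ U n :=
    fun D q => exists_mem_iff_of_isOpen_sections M.measurableSet_K hM.isCompact_actions
      (measurableSet_lt measurable_const (Kernel.measurable_coe _ D.2))
      fun s => isOpen_Ioi.preimage (hM.continuous_p s D D.2)
  choose Br Ur hBr hUr hr using hr
  choose Bp Up hBp hUp hp using hp
  -- Countably many measurable sets, closed under the operations which the topology has to respect.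
  let op : Bool ⊕ ℚ × ℕ → {D : Set S // MeasurableSet D} → {D : Set S // MeasurableSet D} →
      {D : Set S // MeasurableSet D} := fun i D D' =>
    match i with
    | Sum.inl true => ⟨D.1ᶜ, D.2.compl⟩
    | Sum.inl false => ⟨D.1 ∩ D'.1, D.2.inter D'.2⟩
    | Sum.inr (q, n) => ⟨Bp D q n, hBp D q n⟩
  -- These countably many sets separate the points of `S`, which makes the new topology metrizable.
  have hsm : ∀ n, MeasurableSet {s : S | MeasurableSpace.mapNatBool S s n = true} := fun n =>
    measurableSet_eq_fun ((measurable_pi_apply n).comp (MeasurableSpace.measurable_mapNatBool S))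
      measurable_const
  obtain ⟨T, hT, hTc, hTop⟩ := exists_countable_closed_under
    (T₀ := Set.range (fun n => (⟨BK n, hBK n⟩ : {D : Set S // MeasurableSet D})) ∪
      Set.range (fun j : Fin (m + 1) × ℚ × ℕ =>
        (⟨Br j.1 j.2.1 j.2.2, hBr _ _ _⟩ : {D : Set S // MeasurableSet D})) ∪
      Set.range (fun n => (⟨_, hsm n⟩ : {D : Set S // MeasurableSet D})) ∪
      {⟨Set.univ, MeasurableSet.univ⟩})
    ((((Set.countable_range _).union (Set.countable_range _)).union
      (Set.countable_range _)).union (Set.countable_singleton _)) op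
  have huniv : (⟨Set.univ, MeasurableSet.univ⟩ : {D : Set S // MeasurableSet D}) ∈ T :=
    hT (Or.inr rfl)
  obtain ⟨D, rfl⟩ := hTc.exists_eq_range ⟨_, huniv⟩
  have hcompl : ∀ n, ((D n).1)ᶜ ∈ Set.range fun n => (D n).1 := fun n => by
    obtain ⟨k, hk⟩ := hTop (Sum.inl true) (D n) ⟨n, rfl⟩ (D n) ⟨n, rfl⟩
    exact ⟨k, congrArg Subtype.val hk⟩
  have hinter : ∀ n k, (D n).1 ∩ (D k).1 ∈ Set.range fun n => (D n).1 := fun n k => by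
    obtain ⟨j, hj⟩ := hTop (Sum.inl false) (D n) ⟨n, rfl⟩ (D k) ⟨k, rfl⟩
    exact ⟨j, congrArg Subtype.val hj⟩
  have huniv' : Set.univ ∈ Set.range fun n => (D n).1 := by
    obtain ⟨k, hk⟩ := huniv
    exact ⟨k, congrArg Subtype.val hk⟩
  obtain ⟨τ, hmet, hsec, hborel, hDo, hbasis⟩ := exists_topology_of_countable_algebra
    (D := fun n => (D n).1) (fun n => (D n).2) (fun s t hst => by
      refine MeasurableSpace.injective_mapNatBool S (funext fun n => ?_)
      obtain ⟨k, hk⟩ := hT (Or.inl (Or.inr ⟨n, rfl⟩))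
      have h1 := hst k
      rw [hk] at h1
      exact Bool.eq_iff_iff.2 h1) huniv' hcompl hinter
  have hTo : ∀ E ∈ Set.range D, IsOpen E.1 := by
    rintro _ ⟨n, rfl⟩
    exact hDo n
  have hpo : ∀ n (q : ℚ), IsOpen {x : M.K | ENNReal.ofReal q < M.p x (D n).1} := fun n q =>
    isOpen_of_mem_iff (fun k => hTo _ (hTop (Sum.inr (q, k)) (D n) ⟨n, rfl⟩ (D n) ⟨n, rfl⟩))
      (hUp (D n) q) (hp (D n) q)
  have hunion : ∀ n k, (D n).1 ∪ (D k).1 ∈ Set.range fun n => (D n).1 := fun n k => by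
    obtain ⟨n', hn'⟩ := hcompl n
    obtain ⟨k', hk'⟩ := hcompl k
    obtain ⟨j, hj⟩ := hinter n' k'
    obtain ⟨l, hl⟩ := hcompl j
    refine ⟨l, hl.trans ?_⟩
    dsimp only at hn' hk' hj
    rw [hj, hn', hk', Set.compl_inter, compl_compl, compl_compl]
  have hlsc : ∀ G, IsOpen G → LowerSemicontinuous fun x => M.p x G := by
    classical
    intro G hG
    rw [lowerSemicontinuous_iff_isOpen_preimage]
    intro t
    rw [isOpen_iff_forall_mem_open]
    intro x hx
    -- An open `G` is the increasing union of finite unions of algebra members inside it. Continuity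
    -- from below finds one member whose mass already exceeds `t`, and `hpo` gives the
    -- neighbourhood.
    set C : ℕ → Set S := fun n => if (D n).1 ⊆ G then (D n).1 else ∅ with hC
    have hCr : ∀ n, C n ∈ Set.range fun n => (D n).1 := fun n => by
      simp only [hC]
      split_ifs
      · exact ⟨n, rfl⟩
      · obtain ⟨k, hk⟩ := huniv'
        obtain ⟨j, hj⟩ := hcompl k
        refine ⟨j, hj.trans ?_⟩
        dsimp only at hk
        rw [hk, Set.compl_univ]
    have hCG : ⋃ n, C n = G := by
      apply Set.Subset.antisymm
      · refine Set.iUnion_subset fun n => ?_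
        simp only [hC]
        split_ifs with h
        · exact h
        · exact Set.empty_subset _
      · intro s hs
        obtain ⟨n, hsn, hn⟩ := hbasis G hG s hs
        refine Set.mem_iUnion.2 ⟨n, ?_⟩
        simp only [hC]
        rwa [if_pos hn]
    have hacc : ∀ N, Set.accumulate C N ∈ Set.range fun n => (D n).1 := by
      intro N
      induction N with
      | zero => rw [Set.accumulate_zero_nat]; exact hCr 0
      | succ N ih =>
        rw [Set.accumulate_succ]
        obtain ⟨n, hn⟩ := ih
        obtain ⟨k, hk⟩ := hCr (N + 1)
        obtain ⟨j, hj⟩ := hunion n k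
        refine ⟨j, hj.trans ?_⟩
        dsimp only at hn hk
        rw [hn, hk]
    have hx' : t < M.p x G := hx
    rw [← hCG, measure_iUnion_eq_iSup_accumulate, lt_iSup_iff] at hx'
    obtain ⟨N, hN⟩ := hx'
    obtain ⟨n, hn⟩ := hacc N
    dsimp only at hn
    rw [← hn] at hN
    obtain ⟨q, -, htq, hq⟩ := ENNReal.lt_iff_exists_rat_btwn.1 hN
    refine ⟨_, fun y hy => ?_, hpo n q, hq⟩
    refine htq.trans (lt_of_lt_of_le hy (measure_mono ?_))
    rw [hn, ← hCG]
    exact Set.accumulate_subset_iUnion N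
  refine ⟨τ, hmet, hsec, hborel, hM.isCompact_actions,
    hclosed τ fun n => hTo _ (hT (Or.inl (Or.inl (Or.inl ⟨n, rfl⟩)))),
    fun v hv hb => continuous_integral_of_lowerSemicontinuous hlsc hv hb, fun i => ?_⟩
  rw [upperSemicontinuous_iff_isOpen_preimage]
  intro y
  have : M.r i ⁻¹' Set.Iio y =
      ⋃ (q : ℚ) (_ : ((q : ℝ) : EReal) < y), {x | M.r i x < ((q : ℝ) : EReal)} := by
    ext x
    simp only [Set.mem_preimage, Set.mem_Iio, Set.mem_iUnion, Set.mem_ofPred_eq, exists_prop]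
    constructor
    · intro h
      obtain ⟨q, h1, h2⟩ := EReal.exists_rat_btwn_of_lt h
      exact ⟨q, h2, h1⟩
    · rintro ⟨q, h1, h2⟩
      exact h2.trans h1
  rw [this]
  exact isOpen_iUnion fun q => isOpen_iUnion fun _ => isOpen_of_mem_iff
    (fun k => hTo _ (hT (Or.inl (Or.inl (Or.inr ⟨(i, q, k), rfl⟩))))) (hUr i q) (hr i q)

end CMDP

theorem theorem1 {S : Type u} {A : Type v}
    [TopologicalSpace S] [MeasurableSpace S] [BorelSpace S]
    [TopologicalSpace A] [MeasurableSpace A] [BorelSpace A]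
    (hS : IsBorelSpace S) (hA : IsBorelSpace A)
    {m : ℕ} (M : CMDP S A m) (d : Fin m → ℝ) (hd : M.Nontrivial d)
    (w : S → ℝ) (hA1 : M.BoundedAboveBy w) (hA2 : M.UniformlySmallTails w)
    (hcont : M.WeaklyContinuous ∨ M.SetwiseContinuous) :
    ∃ φ : M.StationaryPolicy, M.IsOptimal d φ.toPolicy := by
  have := hS.standardBorelSpace
  have := hA.metrizableSpace
  have := hA.secondCountableTopology
  have := hA.standardBorelSpace
  rcases hcont with hM | hM
  · have := hS.metrizableSpace
    have := hS.secondCountableTopology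
    exact CMDP.exists_isOptimal_of_weaklyContinuous hA1 hA2 hM hd
  -- Policies, their laws and the growth conditions use only the measurable structure, so they carry
  -- over to `τ` unchanged.
  · obtain ⟨τ, _, _, _, hM'⟩ := hM.exists_topology_weaklyContinuous
    exact CMDP.exists_isOptimal_of_weaklyContinuous hA1 hA2 hM' hd
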